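/- A $3$-graph is a finite $3$-uniform hypergraph. For a $3$-graph $H$ and a natural number $n$, let $r(H,K_n^{(3)})$ be the smallest natural number $N$ such that every red/blue-coloring of the edges of the complete $3$-graph $K_N^{(3)}$ contains a red copy of $H$ or a blue copy of $K_n^{(3)}$. A $3$-graph is tightly connected if any two of its edges $e,f$ are joined by a sequence of edges $e=e_0,e_1,\dots,e_t=f$ such that $e_{i-1}$ and $e_i$ share two vertices for all $i=1,\dots,t$; a tight component of $H$ is a maximal tightly connected subgraph of $H$ with at least one edge, and it is identified with its set of edges. An iterated blowup of an edge is a $3$-graph that is either a complete tripartite $3$-graph or formed iteratively from a complete tripartite $3$-graph by placing an iterated blowup of an edge in one or more of its parts. A $3$-graph is iterated tripartite if it is a (not necessarily induced) subgraph of an iterated blowup of an edge. **Theorem 1.3.** Let $H$ be a $3$-graph with at most two tight components. 1. If $H$ is not iterated tripartite, then there is a constant $c>0$, depending only on $H$, such that $r(H,K_n^{(3)})\ge 2^{c\log^2 n}$ for all $n\ge 1$. 2. There is a constant $c$, depending only on $H$, such that $r(H,K_n^{(3)})\le n^{c}$ for all $n$ if and only if $H$ is iterated tripartite. -/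

import Mathlib

/-- A `3`-graph (`3`-uniform hypergraph) on the vertex type `V`. -/
structure ThreeGraph (V : Type*) where
  /-- The set of edges. -/
  edges : Set (Finset V)
  /-- Every edge consists of exactly three vertices. -/
  card_eq : ∀ e ∈ edges, e.card = 3

namespace ThreeGraph

/-- The `3`-graph without edges on the vertex type `V`. -/
def edgeless (V : Type*) : ThreeGraph V where
  edges := ∅
  card_eq := fun _ he => he.elim

/-- The complete `3`-graph on the vertex type `V`. -/
def complete (V : Type*) : ThreeGraph V where
  edges := {e | e.card = 3}
  card_eq := fun _ he => he

/-- The complement of a `3`-graph: its edges are the triples which are not edges of `G`. -/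
def compl {V : Type*} (G : ThreeGraph V) : ThreeGraph V where
  edges := {e | e.card = 3 ∧ e ∉ G.edges}
  card_eq := fun _ he => he.1

/-- `H.IsContained G`: the `3`-graph `G` has a (not necessarily induced) subgraph that is a copy
of `H`. -/
def IsContained {V W : Type*} (H : ThreeGraph V) (G : ThreeGraph W) : Prop :=
  ∃ f : V ↪ W, ∀ e ∈ H.edges, e.map f ∈ G.edges

/-! ### Tight components -/

open Classical in
/-- A set `F` of edges is tightly connected if any two members of `F` are joined by a sequence of
members of `F` in which any two consecutive ones share two vertices. -/
def TightlyConnected {V : Type*} (F : Set (Finset V)) : Prop :=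
  ∀ e ∈ F, ∀ f ∈ F,
    Relation.ReflTransGen (fun a b => a ∈ F ∧ b ∈ F ∧ (a ∩ b).card = 2) e f

/-- The tight components of `H`, given by their edge sets: the maximal nonempty tightly connected
sets of edges of `H`. -/
def tightComponents {V : Type*} (H : ThreeGraph V) : Set (Set (Finset V)) :=
  {F | F.Nonempty ∧ Maximal (fun F' => F' ⊆ H.edges ∧ TightlyConnected F') F}

/-! ### Iterated blowups of an edge -/

/-- Given `3`-graphs `G 0`, `G 1`, `G 2` on the types `P 0`, `P 1`, `P 2`, the `3`-graph on the
disjoint union of the parts `P 0`, `P 1`, `P 2` formed from the complete tripartite `3`-graph with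
these parts by placing `G i` in the part `P i` for every `i`. -/
def placeInBlowup {P : Fin 3 → Type*} (G : ∀ i, ThreeGraph (P i)) :
    ThreeGraph (Σ i, P i) where
  edges := {e | (e.card = 3 ∧ Set.InjOn Sigma.fst (e : Set (Σ i, P i))) ∨
    ∃ i, ∃ e' ∈ (G i).edges, e = e'.map (Function.Embedding.sigmaMk i)}
  card_eq := by
    rintro e (he | ⟨i, e', he', rfl⟩)
    · exact he.1
    · rw [Finset.card_map]
      exact (G i).card_eq e' he'

/-- Iterated blowups of an edge: start with a blowup of an edge, that is, a complete tripartite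
`3`-graph, and place iterated blowups in the parts `P i` with `i ∈ S`, leaving the other parts
edgeless. The case `S = ∅` is the plain blowup of an edge. Parts may be empty, which makes no
difference to which `3`-graphs are contained in an iterated blowup. -/
inductive IsIteratedBlowup : ∀ {W : Type}, ThreeGraph W → Prop
  | place (P : Fin 3 → Type) (finite : ∀ i, Finite (P i)) (G : ∀ i, ThreeGraph (P i))
      (S : Set (Fin 3)) (edgeless_of_notMem : ∀ i, i ∉ S → G i = edgeless (P i))
      (iterated_of_mem : ∀ i, i ∈ S → IsIteratedBlowup (G i)) :
      IsIteratedBlowup (placeInBlowup G)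

/-- A `3`-graph is iterated tripartite if it is contained in an iterated blowup of an edge. -/
def IsIteratedTripartite {V : Type*} (H : ThreeGraph V) : Prop :=
  ∃ (W : Type) (G : ThreeGraph W), IsIteratedBlowup G ∧ H.IsContained G

/-! ### The off-diagonal Ramsey number -/

/-- Every red/blue-coloring of the edges of the complete `3`-graph on `N` vertices contains a red
copy of `H` or a blue copy of the complete `3`-graph on `n` vertices. A coloring is given by the
`3`-graph `R` of its red edges; its blue edges are those of `R.compl`. -/
def Arrows {V : Type*} (H : ThreeGraph V) (n N : ℕ) : Prop :=
  ∀ R : ThreeGraph (Fin N), H.IsContained R ∨ (complete (Fin n)).IsContained R.compl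

/-- The off-diagonal Ramsey number `r(H, K_n)` of a `3`-graph `H` and the complete `3`-graph on `n`
vertices: the smallest `N` such that every red/blue-coloring of the edges of the complete `3`-graph
on `N` vertices contains a red copy of `H` or a blue copy of the complete `3`-graph on `n`
vertices. For finite `H` such `N` exist, see `ramseyNumber_spec`. -/
noncomputable def ramseyNumber {V : Type*} (H : ThreeGraph V) (n : ℕ) : ℕ :=
  sInf {N | H.Arrows n N}

/-- Ramsey's theorem for `k`-uniform hypergraphs and two colors. -/
theorem exists_ramsey (k : ℕ) : ∀ s t : ℕ, ∃ N : ℕ, ∀ (α : Type) (A : Finset α)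
    (red : Finset α → Prop), N ≤ A.card →
      (∃ S ⊆ A, S.card = s ∧ ∀ e ⊆ S, e.card = k → red e) ∨
      (∃ S ⊆ A, S.card = t ∧ ∀ e ⊆ S, e.card = k → ¬ red e) := by
  classical
  induction k with
  | zero =>
    intro s t
    refine ⟨max s t, fun α A red hA => ?_⟩
    by_cases h : red ∅
    · obtain ⟨S, hS, hc⟩ := Finset.exists_subset_card_eq (le_trans (le_max_left s t) hA)
      refine Or.inl ⟨S, hS, hc, fun e _ he => ?_⟩
      rwa [Finset.card_eq_zero.1 he]
    · obtain ⟨S, hS, hc⟩ := Finset.exists_subset_card_eq (le_trans (le_max_right s t) hA)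
      refine Or.inr ⟨S, hS, hc, fun e _ he => ?_⟩
      rwa [Finset.card_eq_zero.1 he]
  | succ k ih =>
    have ext : ∀ {α : Type} {a : α} {S' S : Finset α} {p : Finset α → Prop}, a ∉ S' → S ⊆ S' →
        (∀ e ⊆ S', e.card = k → p (insert a e)) → (∀ e ⊆ S, e.card = k + 1 → p e) →
        ∀ e ⊆ insert a S, e.card = k + 1 → p e := by
      intro α a S' S p ha hSS h1 h2 e he hc
      by_cases hae : a ∈ e
      · have := h1 (e.erase a) ((Finset.subset_insert_iff.1 he).trans hSS)
          (by rw [Finset.card_erase_of_mem hae, hc]; rfl)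
        rwa [Finset.insert_erase hae] at this
      · exact h2 e ((Finset.subset_insert_iff_of_notMem hae).1 he) hc
    intro s
    induction s with
    | zero =>
      intro t
      refine ⟨0, fun α A red _ => Or.inl ⟨∅, by simp, rfl, fun e he hc => ?_⟩⟩
      simp [Finset.subset_empty.1 he] at hc
    | succ s ihs =>
      intro t
      induction t with
      | zero =>
        refine ⟨0, fun α A red _ => Or.inr ⟨∅, by simp, rfl, fun e he hc => ?_⟩⟩
        simp [Finset.subset_empty.1 he] at hc
      | succ t iht =>
        obtain ⟨N₁, hN₁⟩ := ihs (t + 1)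
        obtain ⟨N₂, hN₂⟩ := iht
        obtain ⟨N, hN⟩ := ih N₁ N₂
        refine ⟨N + 1, fun α A red hA => ?_⟩
        obtain ⟨a, ha⟩ : A.Nonempty := Finset.card_pos.1 (by omega)
        have hsub : ∀ {S' S : Finset α}, S' ⊆ A.erase a → S ⊆ S' → insert a S ⊆ A :=
          fun h h' => Finset.insert_subset ha ((h'.trans h).trans (Finset.erase_subset _ _))
        rcases hN α (A.erase a) (fun e => red (insert a e))
          (by rw [Finset.card_erase_of_mem ha]; omega) with ⟨S', hS', hc', h'⟩ | ⟨S', hS', hc', h'⟩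
        · have haS' : a ∉ S' := fun h => Finset.notMem_erase a A (hS' h)
          rcases hN₁ α S' red hc'.ge with ⟨S, hS, hc, h⟩ | ⟨S, hS, hc, h⟩
          · exact Or.inl ⟨insert a S, hsub hS' hS,
              by rw [Finset.card_insert_of_notMem (fun h => haS' (hS h)), hc], ext haS' hS h' h⟩
          · exact Or.inr ⟨S, (hS.trans hS').trans (Finset.erase_subset _ _), hc, h⟩
        · have haS' : a ∉ S' := fun h => Finset.notMem_erase a A (hS' h)
          rcases hN₂ α S' red hc'.ge with ⟨S, hS, hc, h⟩ | ⟨S, hS, hc, h⟩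
          · exact Or.inl ⟨S, (hS.trans hS').trans (Finset.erase_subset _ _), hc, h⟩
          · exact Or.inr ⟨insert a S, hsub hS' hS,
              by rw [Finset.card_insert_of_notMem (fun h => haS' (hS h)), hc],
              ext (p := fun e => ¬ red e) haS' hS h' h⟩

/-- The minimum that defines `ramseyNumber` is attained if `H` is finite. -/
theorem ramseyNumber_spec {V : Type*} [Finite V] (H : ThreeGraph V) (n : ℕ) :
    H.Arrows n (H.ramseyNumber n) := by
  classical
  refine Nat.sInf_mem (s := {N | H.Arrows n N}) ?_
  obtain ⟨N, hN⟩ := exists_ramsey 3 (Nat.card V) n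
  refine ⟨N, fun R => ?_⟩
  rcases hN (Fin N) Finset.univ (fun e => e ∈ R.edges) (by simp) with
    ⟨S, -, hc, h⟩ | ⟨S, -, hc, h⟩
  · have g : V ≃ S := (Finite.equivFin V).trans (S.equivFinOfCardEq hc).symm
    refine Or.inl ⟨g.toEmbedding.trans (Function.Embedding.subtype _), fun e he => h _ ?_ ?_⟩
    · intro x hx
      obtain ⟨y, -, rfl⟩ := Finset.mem_map.1 hx
      exact (g y).2
    · rw [Finset.card_map]
      exact H.card_eq e he
  · have g : Fin n ≃ S := (S.equivFinOfCardEq hc).symm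
    refine Or.inr ⟨g.toEmbedding.trans (Function.Embedding.subtype _), fun e he => ?_⟩
    have hcard : (e.map (g.toEmbedding.trans (Function.Embedding.subtype _))).card = 3 := by
      rw [Finset.card_map]
      exact he
    refine ⟨hcard, h _ ?_ hcard⟩
    intro x hx
    obtain ⟨y, -, rfl⟩ := Finset.mem_map.1 hx
    exact (g y).2

end ThreeGraph

/-! Upper bound: iterated blowups are unavoidable at polynomial size, by induction on their
construction. Take `n` disjoint sets of size `z`, a power of `n`, in a `3`-graph whose `n`-sets all
span edges. Every transversal spans an edge, so three of the sets carry a proportion `n⁻³` of all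
crossing triples (`exists_dense_triple`). By dependent selection (`PolyUnavoidable.exists_common`) a
copy of `G 0` in the first set is completely joined to a polynomial proportion of the pairs from the
other two. The same step inside the second set leaves a large piece of the third, which contains `G
2`.

Lower bound: starting from a single vertex, repeatedly take `m = 2 ^ t` copies of the current
`3`-graph and add crossing edges governed by a coloring of vertex pairs by copies: a crossing triple
is an edge when each of its pairs is colored by the copy of the third vertex. A pair then determines
the copy of every vertex completing it to an edge, so the image of a tightly connected set stays in
one copy or is spread over three fixed copies. Two triples of copies can be simultaneously properly
colored with three colors, so by induction any `H` that is a union of two tightly connected sets and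
maps to the construction is iterated tripartite (`HomsIteratedTripartite.joinCopies`). For three
triples this can fail: 123, 124, 134.

A random coloring puts an edge between any three moderately large sets in distinct copies
(`exists_coloring`), so each round multiplies the bound on edge-free sets only by 3
(`exists_edge_subset_joinCopies`). After `t` rounds there are `2 ^ (t * t)` vertices, yet every set
of `3 ^ t * 2 ^ (9 * t)` vertices spans an edge. This exceeds every polynomial, which also gives the
equivalence. -/

namespace ThreeGraph

/-! ### Polynomial upper bound for iterated tripartite `3`-graphs -/

/-- `K` is polynomially unavoidable: there is `C` such that, in a `3`-graph all of whose `n`-sets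
of vertices span an edge, each set of at least `n ^ C` vertices contains a copy of `K`. -/
def PolyUnavoidable {W : Type} (K : ThreeGraph W) (C : ℕ) : Prop :=
  ∀ n : ℕ, 2 ≤ n → ∀ {X : Type} (R : ThreeGraph X),
    (∀ S : Finset X, S.card = n → ∃ e ∈ R.edges, e ⊆ S) →
    ∀ U : Finset X, n ^ C ≤ U.card →
      ∃ f : W ↪ X, (∀ w, f w ∈ U) ∧ ∀ e ∈ K.edges, e.map f ∈ R.edges

theorem PolyUnavoidable.mono {W : Type} {K : ThreeGraph W} {C D : ℕ}
    (h : K.PolyUnavoidable C) (hCD : C ≤ D) : K.PolyUnavoidable D :=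
  fun n hn _ R hR U hU => h n hn R hR U ((Nat.pow_le_pow_right (by omega) hCD).trans hU)

theorem polyUnavoidable_edgeless (W : Type) [Finite W] :
    (edgeless W).PolyUnavoidable (Nat.card W) := by
  classical
  intro n hn X R _ U hU
  have := Fintype.ofFinite W
  have hW : Fintype.card W ≤ Fintype.card U := by
    rw [Fintype.card_coe, ← Nat.card_eq_fintype_card]
    exact (Nat.lt_pow_self (by omega)).le.trans hU
  obtain ⟨f⟩ := Function.Embedding.nonempty_of_card_le hW
  exact ⟨f.trans (Function.Embedding.subtype _), fun w => (f w).2, fun e he => he.elim⟩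

/-- Some subset of a given size has at least the average weight. -/
theorem exists_subset_card_eq_average {ι : Type*} (f : ι → ℕ) (p : ℕ) (s : Finset ι)
    (hp : p ≤ s.card) : ∃ t ⊆ s, t.card = p ∧ p * ∑ i ∈ s, f i ≤ s.card * ∑ i ∈ t, f i := by
  classical
  obtain ⟨k, hk⟩ := Nat.exists_eq_add_of_le hp
  induction k generalizing s with
  | zero => exact ⟨s, subset_rfl, by omega, by rw [hk]; simp⟩
  | succ k ih =>
    have hne : s.Nonempty := Finset.card_pos.1 (by omega)
    obtain ⟨x, hx, hmin⟩ := Finset.exists_min_image s f hne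
    have hc : (s.erase x).card = p + k := by rw [Finset.card_erase_of_mem hx]; omega
    obtain ⟨t, ht, htc, hle⟩ := ih (s.erase x) (by omega) hc
    refine ⟨t, ht.trans (Finset.erase_subset _ _), htc, ?_⟩
    have hsum : ∑ i ∈ s.erase x, f i + f x = ∑ i ∈ s, f i := Finset.sum_erase_add _ _ hx
    have h1 : t.card • f x ≤ ∑ i ∈ t, f i := Finset.card_nsmul_le_sum _ _ _
      fun i hi => hmin i (Finset.mem_of_mem_erase (ht hi))
    rw [hc] at hle
    rw [htc, smul_eq_mul] at h1
    rw [hk, ← hsum, Nat.mul_add]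
    calc p * ∑ i ∈ s.erase x, f i + p * f x ≤ (p + k) * ∑ i ∈ t, f i + ∑ i ∈ t, f i :=
          Nat.add_le_add hle h1
      _ = (p + (k + 1)) * ∑ i ∈ t, f i := by ring

/-- The pigeonhole principle: some fiber has at least the average size. -/
theorem exists_card_le_mul_card_fiber {α β : Type*} [DecidableEq β] {s : Finset α} {t : Finset β}
    (hs : s.Nonempty) (f : α → β) (hf : ∀ a ∈ s, f a ∈ t) :
    ∃ b ∈ t, s.card ≤ t.card * (s.filter fun a => f a = b).card := by
  by_contra! h
  have ht : t.Nonempty := hs.elim fun a ha => ⟨f a, hf a ha⟩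
  have h1 : ∑ b ∈ t, t.card * (s.filter fun a => f a = b).card < ∑ _b ∈ t, s.card :=
    Finset.sum_lt_sum_of_nonempty ht h
  rw [← Finset.mul_sum, ← Finset.card_eq_sum_card_fiberwise hf, Finset.sum_const,
    smul_eq_mul] at h1
  exact lt_irrefl _ h1

/-- If vertices of `X` and tests in `T` are related with density at least `n⁻ᵈ`, then a copy of `K`
in `X` is completely related to a polynomial proportion of the tests. -/
theorem PolyUnavoidable.exists_common {W : Type} [Finite W] {K : ThreeGraph W} {C : ℕ}
    (hK : K.PolyUnavoidable C) {n : ℕ} (hn : 2 ≤ n) {V : Type} {R : ThreeGraph V}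
    (hR : ∀ S : Finset V, S.card = n → ∃ e ∈ R.edges, e ⊆ S) {τ : Type} (T : Finset τ)
    (hT : T.Nonempty) (X : Finset V) (d : ℕ) (hX : n ^ (C + d + 1) ≤ X.card)
    (rel : V → τ → Prop) [∀ x t, Decidable (rel x t)]
    (hrel : X.card * T.card ≤ n ^ d * ∑ x ∈ X, (T.filter (rel x)).card) :
    ∃ f : W ↪ V, (∀ w, f w ∈ X) ∧ (∀ e ∈ K.edges, e.map f ∈ R.edges) ∧
      ∃ T' ⊆ T, T.card ≤ n ^ (d + 1 + (C + d + 1) * Nat.card W) * T'.card ∧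
        ∀ t ∈ T', ∀ w, rel (f w) t := by
  classical
  have := Fintype.ofFinite W
  set p := n ^ (C + d + 1) with hp
  have hn0 : 0 < n := by omega
  have hppos : 0 < p := by positivity
  -- Shrinking `X` to exactly `p` vertices keeps the density and makes the number of possible copies
  -- of `K` polynomial in `n`, whatever the size of `X`.
  obtain ⟨Y, hYX, hYc, hY⟩ := exists_subset_card_eq_average
    (fun x => (T.filter (rel x)).card) p X hX
  have hXpos : 0 < X.card := hppos.trans_le hX
  have h1 : p * T.card ≤ n ^ d * ∑ x ∈ Y, (T.filter (rel x)).card := by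
    refine Nat.le_of_mul_le_mul_left ?_ hXpos
    calc X.card * (p * T.card) = p * (X.card * T.card) := by ring
      _ ≤ p * (n ^ d * ∑ x ∈ X, (T.filter (rel x)).card) := Nat.mul_le_mul_left _ hrel
      _ = n ^ d * (p * ∑ x ∈ X, (T.filter (rel x)).card) := by ring
      _ ≤ n ^ d * (X.card * ∑ x ∈ Y, (T.filter (rel x)).card) := Nat.mul_le_mul_left _ hY
      _ = X.card * (n ^ d * ∑ x ∈ Y, (T.filter (rel x)).card) := by ring
  have hswap : ∑ x ∈ Y, (T.filter (rel x)).card =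
      ∑ t ∈ T, (Y.filter fun x => rel x t).card := by
    simp only [Finset.card_filter]
    exact Finset.sum_comm
  set good := T.filter fun t => n ^ C ≤ (Y.filter fun x => rel x t).card with hgood
  have h2 : ∑ t ∈ T, (Y.filter fun x => rel x t).card ≤ p * good.card + n ^ C * T.card := by
    rw [← Finset.sum_filter_add_sum_filter_not T
      (fun t => n ^ C ≤ (Y.filter fun x => rel x t).card)]
    refine Nat.add_le_add ?_ ?_
    · rw [mul_comm]
      refine Finset.sum_le_card_nsmul _ _ _ fun t _ => ?_
      rw [← hYc]
      exact Finset.card_filter_le _ _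
    · refine (Finset.sum_le_card_nsmul _ _ (n ^ C) fun t ht => ?_).trans ?_
      · have := (Finset.mem_filter.1 ht).2
        omega
      · rw [smul_eq_mul, mul_comm]
        exact Nat.mul_le_mul_left _ (Finset.card_filter_le _ _)
  -- Tests that are not good contribute at most `n ^ C * T.card` incidences. The extra factor `n ≥
  -- 2` in `p` makes this at most half of the total.
  have h3 : T.card ≤ n ^ (d + 1) * good.card := by
    rw [hswap] at h1
    have h4 : p * T.card ≤ n ^ d * (p * good.card + n ^ C * T.card) :=
      h1.trans (Nat.mul_le_mul_left _ h2)
    have h5 : 2 * (n ^ (C + d) * T.card) ≤ p * T.card := by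
      rw [hp, pow_succ, ← mul_assoc, mul_comm 2, mul_assoc, mul_assoc]
      exact Nat.mul_le_mul_left _ (Nat.mul_le_mul_right _ hn)
    have h6 : n ^ d * (p * good.card + n ^ C * T.card)
        = p * (n ^ d * good.card) + n ^ (C + d) * T.card := by rw [pow_add]; ring
    rw [h6] at h4
    have h7 : p * T.card ≤ 2 * (p * (n ^ d * good.card)) := by omega
    refine Nat.le_of_mul_le_mul_left (h7.trans ?_) hppos
    calc 2 * (p * (n ^ d * good.card)) ≤ n * (p * (n ^ d * good.card)) :=
          Nat.mul_le_mul_right _ hn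
      _ = p * (n ^ (d + 1) * good.card) := by ring
  have hgne : good.Nonempty := by
    rw [← Finset.card_pos]
    by_contra h0
    have : good.card = 0 := by omega
    rw [this, Nat.mul_zero] at h3
    exact absurd (Finset.card_pos.2 hT) (by omega)
  have hcopy : ∀ t ∈ good, ∃ f : W ↪ V, (∀ w, f w ∈ Y ∧ rel (f w) t) ∧
      ∀ e ∈ K.edges, e.map f ∈ R.edges := by
    intro t ht
    obtain ⟨f, hf, hfe⟩ := hK n hn R hR _ (Finset.mem_filter.1 ht).2
    exact ⟨f, fun w => Finset.mem_filter.1 (hf w), hfe⟩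
  obtain ⟨t₀, ht₀⟩ := hgne
  obtain ⟨f₀, -⟩ := hcopy t₀ ht₀
  have : Nonempty (W ↪ V) := ⟨f₀⟩
  choose! F hFY hFe using hcopy
  -- There are at most `p ^ |W|` maps from `W` to `Y`, so many good tests share the same copy of
  -- `K`.
  obtain ⟨g, -, hg⟩ := exists_card_le_mul_card_fiber (t := Fintype.piFinset fun _ : W => Y)
    ⟨t₀, ht₀⟩ (fun t w => F t w)
    (fun t ht => Fintype.mem_piFinset.2 fun w => (hFY t ht w).1)
  rw [Fintype.card_piFinset, Finset.prod_const, Finset.card_univ, hYc] at hg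
  set T' := good.filter fun t => (fun w => F t w) = g with hT'
  have hT'ne : T'.Nonempty := by
    rw [← Finset.card_pos]
    by_contra h0
    have : T'.card = 0 := by omega
    rw [this, Nat.mul_zero] at hg
    exact absurd (Finset.card_pos.2 ⟨t₀, ht₀⟩) (by omega)
  obtain ⟨t₁, ht₁⟩ := hT'ne
  obtain ⟨ht₁g, ht₁F⟩ := Finset.mem_filter.1 ht₁
  refine ⟨F t₁, fun w => hYX (hFY t₁ ht₁g w).1, hFe t₁ ht₁g, T',
    (Finset.filter_subset _ _).trans (Finset.filter_subset _ _), ?_, ?_⟩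
  · rw [Nat.card_eq_fintype_card, pow_add, pow_mul, mul_assoc]
    exact h3.trans (Nat.mul_le_mul_left _ hg)
  · intro t ht w
    obtain ⟨htg, htF⟩ := Finset.mem_filter.1 ht
    have : F t₁ w = F t w := congrFun (ht₁F.trans htF.symm) w
    rw [this]
    exact (hFY t htg w).2

/-- If every `n`-set spans an edge, then among `n` disjoint sets of equal size some three span a
proportion of at least `n⁻³` of all transversal triples. -/
theorem exists_dense_triple {n z : ℕ} {V : Type} [DecidableEq V] {R : ThreeGraph V}
    (hz : 0 < z) (φ : Fin n × Fin z ↪ V)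
    (hR : ∀ S : Finset V, S.card = n → ∃ e ∈ R.edges, e ⊆ S) :
    ∃ i j k : Fin n, i ≠ j ∧ i ≠ k ∧ j ≠ k ∧ ∃ A : Finset (Fin z × Fin z × Fin z),
      z ^ 3 ≤ n ^ 3 * A.card ∧
      ∀ a ∈ A, {φ (i, a.1), φ (j, a.2.1), φ (k, a.2.2)} ∈ R.edges := by
  classical
  have key : ∀ a : Fin n → Fin z, ∃ q : Fin n × Fin n × Fin n,
      q.1 ≠ q.2.1 ∧ q.1 ≠ q.2.2 ∧ q.2.1 ≠ q.2.2 ∧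
      {φ (q.1, a q.1), φ (q.2.1, a q.2.1), φ (q.2.2, a q.2.2)} ∈ R.edges := by
    intro a
    have hinj : Function.Injective fun i : Fin n => φ (i, a i) := fun i j h =>
      congrArg Prod.fst (φ.injective h)
    obtain ⟨e, he, heS⟩ := hR (Finset.univ.image fun i : Fin n => φ (i, a i))
      (by rw [Finset.card_image_of_injective _ hinj]; simp)
    obtain ⟨x, y, w, hxy, hxw, hyw, rfl⟩ := Finset.card_eq_three.1 (R.card_eq e he)
    obtain ⟨i, -, rfl⟩ := Finset.mem_image.1 (heS (show x ∈ _ by simp))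
    obtain ⟨j, -, rfl⟩ := Finset.mem_image.1 (heS (show y ∈ _ by simp))
    obtain ⟨k, -, rfl⟩ := Finset.mem_image.1 (heS (show w ∈ _ by simp))
    exact ⟨(i, j, k), fun h => hxy (by rw [show i = j from h]),
      fun h => hxw (by rw [show i = k from h]), fun h => hyw (by rw [show j = k from h]), he⟩
  choose q hq1 hq2 hq3 hqe using key
  obtain ⟨⟨i, j, k⟩, -, hb⟩ := exists_card_le_mul_card_fiber (s := Finset.univ)
    (t := Finset.univ) ⟨fun _ : Fin n => (⟨0, hz⟩ : Fin z), Finset.mem_univ _⟩ q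
    (fun _ _ => Finset.mem_univ _)
  set B := Finset.univ.filter fun a => q a = (i, j, k) with hB
  simp only [Finset.card_univ, Fintype.card_prod, Fintype.card_fin, Fintype.card_fun] at hb
  have hBne : B.Nonempty := by
    rw [← Finset.card_pos]
    by_contra h0
    have h00 : B.card = 0 := by omega
    rw [h00, Nat.mul_zero] at hb
    exact absurd (Nat.pow_pos (n := n) hz) (by omega)
  obtain ⟨a₀, ha₀⟩ := hBne
  have hq₀ : q a₀ = (i, j, k) := (Finset.mem_filter.1 ha₀).2
  have hij : i ≠ j := by simpa [hq₀] using hq1 a₀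
  have hik : i ≠ k := by simpa [hq₀] using hq2 a₀
  have hjk : j ≠ k := by simpa [hq₀] using hq3 a₀
  set A : Finset (Fin z × Fin z × Fin z) := Finset.univ.filter fun a =>
    ({φ (i, a.1), φ (j, a.2.1), φ (k, a.2.2)} : Finset V) ∈ R.edges with hA
  refine ⟨i, j, k, hij, hik, hjk, A, ?_, fun a ha => (Finset.mem_filter.1 ha).2⟩
  set Q : Finset (Fin n) := {i, j, k} with hQ
  have hQc : Q.card = 3 := Finset.card_eq_three.2 ⟨i, j, k, hij, hik, hjk, rfl⟩
  have hn3 : 3 ≤ n := by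
    have := Finset.card_le_univ Q
    rwa [hQc, Fintype.card_fin] at this
  -- A transversal in `B` is determined by its entries at `i, j, k`, which form a member of `A`, and
  -- its `n - 3` other entries.
  have hBA : B.card ≤ A.card * z ^ (n - 3) := by
    have hmaps : ∀ a ∈ B, ((a i, a j, a k), fun l : {l // l ∉ Q} => a l) ∈
        A ×ˢ (Finset.univ : Finset ({l // l ∉ Q} → Fin z)) := by
      intro a ha
      have hqa : q a = (i, j, k) := (Finset.mem_filter.1 ha).2
      refine Finset.mem_product.2 ⟨Finset.mem_filter.2 ⟨Finset.mem_univ _, ?_⟩,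
        Finset.mem_univ _⟩
      simpa [hqa] using hqe a
    have := Finset.card_le_card_of_injOn (t := A ×ˢ (Finset.univ : Finset ({l // l ∉ Q} → Fin z)))
      (fun a : Fin n → Fin z => ((a i, a j, a k), fun l : {l // l ∉ Q} => a l)) hmaps ?_
    · rw [Finset.card_product, Finset.card_univ, Fintype.card_fun, Fintype.card_fin,
        Fintype.card_subtype_compl, Fintype.card_fin, Fintype.card_coe, hQc] at this
      exact this
    · intro a _ b _ hab
      simp only [Prod.mk.injEq] at hab
      obtain ⟨⟨h1, h2, h3⟩, h4⟩ := hab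
      funext l
      by_cases hl : l ∈ Q
      · simp only [hQ, Finset.mem_insert, Finset.mem_singleton] at hl
        rcases hl with rfl | rfl | rfl <;> assumption
      · exact congrFun h4 ⟨l, hl⟩
  refine Nat.le_of_mul_le_mul_right ?_ (Nat.pow_pos (n := n - 3) hz)
  calc z ^ 3 * z ^ (n - 3) = z ^ n := by rw [← pow_add]; congr 1; omega
    _ ≤ n * (n * n) * B.card := hb
    _ ≤ n * (n * n) * (A.card * z ^ (n - 3)) := Nat.mul_le_mul_left _ hBA
    _ = n ^ 3 * A.card * z ^ (n - 3) := by ring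

/-- Double counting of `A` by first coordinates. The relation is phrased on `V` through `g` to fit
the density hypothesis of `PolyUnavoidable.exists_common`. -/
theorem sum_card_filter_fiber {α τ V : Type*} [Fintype α] [Fintype τ] [DecidableEq α]
    (g : α ↪ V) (A : Finset (α × τ))
    [∀ v t, Decidable (∃ x, g x = v ∧ (x, t) ∈ A)] :
    ∑ x, (Finset.univ.filter fun t => ∃ x', g x' = g x ∧ (x', t) ∈ A).card = A.card := by
  classical
  rw [Finset.card_eq_sum_card_fiberwise (f := Prod.fst) (t := Finset.univ)
    (fun _ _ => Finset.mem_univ _)]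
  refine Finset.sum_congr rfl fun x _ => ?_
  refine Finset.card_bij (fun t _ => (x, t)) ?_ ?_ ?_
  · intro t ht
    simpa using ht
  · intro t _ t' _ h
    simpa using h
  · rintro ⟨x', t⟩ h
    obtain ⟨h1, rfl⟩ := Finset.mem_filter.1 h
    exact ⟨t, by simpa using h1, rfl⟩

theorem injective_vec_three {α : Type*} {i j k : α} (hij : i ≠ j) (hik : i ≠ k) (hjk : j ≠ k) :
    Function.Injective ![i, j, k] := by
  intro a b h
  fin_cases a <;> fin_cases b <;>
    first
    | rfl
    | exact absurd h hij
    | exact absurd h hik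
    | exact absurd h hjk
    | exact absurd h hij.symm
    | exact absurd h hik.symm
    | exact absurd h hjk.symm

/-- The three parts are embedded one after another. The losses are `n ^ 3` for the dense triple, `n
^ d₁` after embedding `G 0` and `n ^ d₂` after `G 1`; the exponent of `z` dominates what each of the
three embeddings requires. -/
theorem PolyUnavoidable.placeInBlowup {P : Fin 3 → Type} (hP : ∀ i, Finite (P i))
    {G : ∀ i, ThreeGraph (P i)} (hG : ∀ i, ∃ C, (G i).PolyUnavoidable C) :
    ∃ C, (placeInBlowup G).PolyUnavoidable C := by
  classical
  choose C' hC' using hG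
  obtain ⟨C, hC⟩ : ∃ C, ∀ i, (G i).PolyUnavoidable C :=
    ⟨C' 0 + C' 1 + C' 2, fun i => (hC' i).mono (by fin_cases i <;> simp <;> omega)⟩
  set d₁ := 3 + 1 + (C + 3 + 1) * Nat.card (P 0) with hd₁
  set d₂ := d₁ + 1 + (C + d₁ + 1) * Nat.card (P 1) with hd₂
  refine ⟨C + d₁ + d₂ + 4 + 1, fun n hn V R hR U hU => ?_⟩
  set z := n ^ (C + d₁ + d₂ + 4) with hz
  have hn0 : 0 < n := by omega
  have hz0 : 0 < z := by positivity
  obtain ⟨φ⟩ : Nonempty (Fin n × Fin z ↪ U) := by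
    refine Function.Embedding.nonempty_of_card_le ?_
    rw [Fintype.card_prod, Fintype.card_fin, Fintype.card_fin, Fintype.card_coe, mul_comm,
      hz, ← pow_succ]
    exact hU
  let ψ : Fin n × Fin z ↪ V := φ.trans (Function.Embedding.subtype _)
  have hψU : ∀ x, ψ x ∈ U := fun x => (φ x).2
  obtain ⟨i, j, k, hij, hik, hjk, A, hAc, hA⟩ := exists_dense_triple hz0 ψ hR
  let part : Fin n → Fin z ↪ V := fun l => ⟨fun x => ψ (l, x), fun x y h =>
    congrArg Prod.snd (ψ.injective h)⟩
  have hle : ∀ E, E ≤ C + d₁ + d₂ + 4 → n ^ E ≤ z := fun E hE => Nat.pow_le_pow_right hn0 hE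
  have hcard : ∀ l, (Finset.univ.map (part l)).card = z := fun l => by simp
  have : Nonempty (Fin z) := ⟨⟨0, hz0⟩⟩
  -- The tests are the pairs from the second and third sets; in the next application they are the
  -- vertices of the third set, related through `T₁`.
  obtain ⟨f₀, hf₀, hf₀e, T₁, -, hT₁c, hT₁⟩ := (hC 0).exists_common hn hR
    (Finset.univ : Finset (Fin z × Fin z)) Finset.univ_nonempty (Finset.univ.map (part i)) 3
    (by rw [hcard]; exact hle _ (by omega))
    (fun v t => ∃ x, part i x = v ∧ (x, t) ∈ A) (by
      rw [hcard, Finset.sum_map, Finset.card_univ, Fintype.card_prod, Fintype.card_fin]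
      rw [sum_card_filter_fiber]
      calc z * (z * z) = z ^ 3 := by ring
        _ ≤ _ := hAc)
  rw [Finset.card_univ, Fintype.card_prod, Fintype.card_fin, ← hd₁] at hT₁c
  obtain ⟨f₁, hf₁, hf₁e, T₂, -, hT₂c, hT₂⟩ := (hC 1).exists_common hn hR
    (Finset.univ : Finset (Fin z)) Finset.univ_nonempty (Finset.univ.map (part j)) d₁
    (by rw [hcard]; exact hle _ (by omega))
    (fun v t => ∃ y, part j y = v ∧ (y, t) ∈ T₁) (by
      rw [hcard, Finset.sum_map, Finset.card_univ, Fintype.card_fin]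
      rw [sum_card_filter_fiber]
      exact hT₁c)
  rw [Finset.card_univ, Fintype.card_fin, ← hd₂] at hT₂c
  obtain ⟨f₂, hf₂, hf₂e⟩ := hC 2 n hn R hR (T₂.map (part k)) (by
    rw [Finset.card_map]
    refine Nat.le_of_mul_le_mul_left (le_trans ?_ hT₂c) (Nat.pow_pos (n := d₂) hn0)
    rw [← pow_add]
    exact hle _ (by omega))
  let F : ∀ t : Fin 3, P t ↪ V := fun t => match t with
    | 0 => f₀
    | 1 => f₁
    | 2 => f₂
  let ix : Fin 3 → Fin n := ![i, j, k]
  have hix : Function.Injective ix := injective_vec_three hij hik hjk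
  have hFe : ∀ t, ∀ e ∈ (G t).edges, e.map (F t) ∈ R.edges := fun t => match t with
    | 0 => hf₀e
    | 1 => hf₁e
    | 2 => hf₂e
  have hFpart : ∀ t p, ∃ x, F t p = ψ (ix t, x) := by
    have haux : ∀ l v, v ∈ Finset.univ.map (part l) → ∃ x, v = ψ (l, x) := by
      intro l v hv
      obtain ⟨x, -, rfl⟩ := Finset.mem_map.1 hv
      exact ⟨x, rfl⟩
    exact fun t => match t with
    | 0 => fun p => haux i _ (hf₀ p)
    | 1 => fun p => haux j _ (hf₁ p)
    | 2 => fun p => haux k _ (Finset.map_subset_map.2 (Finset.subset_univ _) (hf₂ p))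
  let f : (Σ t, P t) ↪ V := ⟨fun p => F p.1 p.2, by
    rintro ⟨t, p⟩ ⟨t', p'⟩ h
    obtain ⟨x, hx⟩ := hFpart t p
    obtain ⟨x', hx'⟩ := hFpart t' p'
    have h' : F t p = F t' p' := h
    rw [hx, hx'] at h'
    obtain rfl : t = t' := hix (congrArg Prod.fst (ψ.injective h'))
    exact congrArg (Sigma.mk t) ((F t).injective h)⟩
  have hcross : ∀ p₀ p₁ p₂, {f₀ p₀, f₁ p₁, f₂ p₂} ∈ R.edges := by
    intro p₀ p₁ p₂
    obtain ⟨w, hw, hwe⟩ := Finset.mem_map.1 (hf₂ p₂)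
    obtain ⟨y, hy, hyw⟩ := hT₂ w hw p₁
    obtain ⟨x, hx, hxyw⟩ := hT₁ _ hyw p₀
    have := hA _ hxyw
    rw [← hx, ← hy, ← hwe]
    exact this
  refine ⟨f, fun p => ?_, ?_⟩
  · obtain ⟨x, hx⟩ := hFpart p.1 p.2
    change F p.1 p.2 ∈ U
    rw [hx]
    exact hψU _
  · rintro e (⟨hec, hei⟩ | ⟨t, e', he', rfl⟩)
    · have himg : e.image Sigma.fst = Finset.univ := by
        refine Finset.eq_univ_of_card _ ?_
        rw [Finset.card_image_of_injOn hei, hec, Fintype.card_fin]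
      have hex : ∀ t : Fin 3, ∃ p : P t, (⟨t, p⟩ : Σ t, P t) ∈ e := by
        intro t
        obtain ⟨⟨t', p⟩, hp, rfl⟩ := Finset.mem_image.1 (himg ▸ Finset.mem_univ t)
        exact ⟨p, hp⟩
      choose p hp using hex
      have he : ({⟨0, p 0⟩, ⟨1, p 1⟩, ⟨2, p 2⟩} : Finset (Σ t, P t)) = e := by
        refine Finset.eq_of_subset_of_card_le ?_ ?_
        · intro x hx
          simp only [Finset.mem_insert, Finset.mem_singleton] at hx
          rcases hx with rfl | rfl | rfl <;> exact hp _
        · rw [hec, Finset.card_eq_three.2 ⟨_, _, _, ?_, ?_, ?_, rfl⟩] <;>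
            simp [Sigma.ext_iff]
      rw [← he]
      have := hcross (p 0) (p 1) (p 2)
      rw [Finset.map_insert, Finset.map_insert, Finset.map_singleton]
      exact this
    · rw [Finset.map_map]
      exact hFe t e' he'

theorem IsIteratedBlowup.exists_polyUnavoidable {W : Type} {G : ThreeGraph W}
    (hG : IsIteratedBlowup G) : Finite W ∧ ∃ C, G.PolyUnavoidable C := by
  induction hG with
  | place P finite G S hS _ ih =>
    refine ⟨inferInstance, PolyUnavoidable.placeInBlowup finite fun i => ?_⟩
    by_cases hi : i ∈ S
    · exact (ih i hi).2
    · have := finite i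
      exact ⟨_, hS i hi ▸ polyUnavoidable_edgeless (P i)⟩

theorem complete_isContained_compl {X : Type*} {R : ThreeGraph X} {n : ℕ} {S : Finset X}
    (hS : S.card = n) (h : ∀ e ∈ R.edges, ¬ e ⊆ S) :
    (complete (Fin n)).IsContained R.compl := by
  have g : Fin n ≃ S := (S.equivFinOfCardEq hS).symm
  refine ⟨g.toEmbedding.trans (Function.Embedding.subtype _), fun e he =>
    ⟨(Finset.card_map _).trans he, fun hR => h _ hR fun x hx => ?_⟩⟩
  obtain ⟨y, -, rfl⟩ := Finset.mem_map.1 hx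
  exact (g y).2

theorem arrows_self {V : Type*} (H : ThreeGraph V) {n : ℕ} (hn : n ≤ 2) : H.Arrows n n := by
  refine fun R => Or.inr (complete_isContained_compl (S := Finset.univ) (by simp)
    fun e he _ => ?_)
  have := (R.card_eq e he).symm.trans_le (Finset.card_le_univ e)
  rw [Fintype.card_fin] at this
  omega

/-- The off-diagonal Ramsey number of an iterated tripartite `3`-graph is polynomially bounded. -/
theorem IsIteratedTripartite.exists_ramseyNumber_le_pow {V : Type*} {H : ThreeGraph V}
    (hH : H.IsIteratedTripartite) : ∃ c : ℕ, ∀ n : ℕ, H.ramseyNumber n ≤ n ^ c := by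
  obtain ⟨W, G, hG, g, hg⟩ := hH
  obtain ⟨-, C, hC⟩ := hG.exists_polyUnavoidable
  refine ⟨C + 1, fun n => ?_⟩
  rcases lt_or_ge n 2 with hn | hn
  · have : n ^ (C + 1) = n := by interval_cases n <;> simp
    rw [this]
    exact Nat.sInf_le (H.arrows_self hn.le)
  · refine (Nat.sInf_le fun R => ?_).trans (Nat.pow_le_pow_right (by omega) (Nat.le_succ C))
    by_cases hR : ∀ S : Finset (Fin (n ^ C)), S.card = n → ∃ e ∈ R.edges, e ⊆ S
    · obtain ⟨f, -, hf⟩ := hC n hn R hR Finset.univ (by simp)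
      refine Or.inl ⟨g.trans f, fun e he => ?_⟩
      rw [← Finset.map_map]
      exact hf _ (hg e he)
    · push Not at hR
      obtain ⟨S, hS, h⟩ := hR
      exact Or.inr (complete_isContained_compl hS h)

/-! ### Iterated tripartite `3`-graphs and tight connectivity -/

theorem isIteratedTripartite_of_edges_eq_empty {V : Type*} [Finite V] {H : ThreeGraph V}
    (hH : H.edges = ∅) : H.IsIteratedTripartite := by
  refine ⟨_, _, IsIteratedBlowup.place (fun _ => Fin (Nat.card V)) (fun _ => inferInstance)
    (fun _ => edgeless _) ∅ (fun _ _ => rfl) (fun _ h => h.elim),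
    (Finite.equivFin V).toEmbedding.trans
      (Function.Embedding.sigmaMk (β := fun _ : Fin 3 => Fin (Nat.card V)) 0), fun e he => ?_⟩
  rw [hH] at he
  exact he.elim

/-- A `3`-graph is iterated tripartite if its vertices can be split into three classes such that
each edge either meets all classes or lies in an iterated tripartite `3`-graph in one class. -/
theorem isIteratedTripartite_of_classes {V : Type*} {H : ThreeGraph V} (c : V → Fin 3)
    (K : Fin 3 → ThreeGraph V) (hK : ∀ t, (K t).IsIteratedTripartite)
    (hH : ∀ e ∈ H.edges, Set.InjOn c e ∨ ∃ t, (∀ v ∈ e, c v = t) ∧ e ∈ (K t).edges) :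
    H.IsIteratedTripartite := by
  choose W G hG f hf using hK
  -- Each part hosts a copy of all of `V`, of which only the vertices of the corresponding class are
  -- used.
  let g : V ↪ Σ t, W t := ⟨fun v => ⟨c v, f (c v) v⟩, fun v w h => by
    obtain ⟨h1, h2⟩ := Sigma.mk.inj h
    rw [h1] at h2
    exact (f (c w)).injective (eq_of_heq h2)⟩
  refine ⟨_, _, IsIteratedBlowup.place W (fun t => (hG t).exists_polyUnavoidable.1) G Set.univ
    (fun t ht => (ht trivial).elim) (fun t _ => hG t), g, fun e he => ?_⟩
  rcases hH e he with h | ⟨t, ht, het⟩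
  · refine Or.inl ⟨(Finset.card_map _).trans (H.card_eq e he), ?_⟩
    intro x hx y hy hxy
    rw [Finset.coe_map] at hx hy
    obtain ⟨v, hv, rfl⟩ := hx
    obtain ⟨w, hw, rfl⟩ := hy
    rw [h hv hw hxy]
  · refine Or.inr ⟨t, e.map (f t), hf t e het, ?_⟩
    rw [Finset.map_map]
    ext x
    simp only [Finset.mem_map]
    refine exists_congr fun v => and_congr_right fun hv => ?_
    obtain rfl := ht v hv
    rfl

theorem tightlyConnected_empty {V : Type*} : TightlyConnected (∅ : Set (Finset V)) :=
  fun _ h => h.elim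

/-- A function on the edges that agrees on edges with two common vertices is constant on tightly
connected sets. -/
theorem TightlyConnected.apply_eq {V α : Type*} {T : Set (Finset V)} (hT : TightlyConnected T)
    (ℓ : Finset V → α)
    (hℓ : ∀ e ∈ T, ∀ f ∈ T, ∀ u v, u ≠ v → u ∈ e → u ∈ f → v ∈ e → v ∈ f → ℓ e = ℓ f)
    {e f : Finset V} (he : e ∈ T) (hf : f ∈ T) : ℓ e = ℓ f := by
  classical
  have h := hT e he f hf
  clear hf
  induction h with
  | refl => rfl
  | tail _ hab ih =>
    obtain ⟨ha, hb, hc⟩ := hab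
    obtain ⟨u, v, huv, h⟩ := Finset.card_eq_two.1 hc
    have hu := Finset.mem_inter.1 (h ▸ Finset.mem_insert_self u {v})
    have hv := Finset.mem_inter.1
      (h ▸ Finset.mem_insert_of_mem (Finset.mem_singleton_self v) : v ∈ _)
    exact ih.trans (hℓ _ ha _ hb u v huv hu.1 hu.2 hv.1 hv.2)

/-- Every edge lies in a tight component. -/
theorem exists_mem_tightComponents {V : Type*} (H : ThreeGraph V) {e : Finset V}
    (he : e ∈ H.edges) : ∃ F ∈ H.tightComponents, e ∈ F := by
  classical
  set r : Finset V → Finset V → Prop :=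
    fun a b => a ∈ H.edges ∧ b ∈ H.edges ∧ (a ∩ b).card = 2 with hr
  set F : Set (Finset V) := {f | f ∈ H.edges ∧ Relation.ReflTransGen r e f} with hF
  have heF : e ∈ F := ⟨he, .refl⟩
  -- Tight connectivity asks for walks inside `F`; a walk from `e` stays there because everything it
  -- visits is reachable.
  have key : ∀ f, Relation.ReflTransGen r e f →
      Relation.ReflTransGen (fun a b => a ∈ F ∧ b ∈ F ∧ (a ∩ b).card = 2) e f := by
    intro f h
    induction h with
    | refl => exact .refl
    | tail h hab ih => exact ih.tail ⟨⟨hab.1, h⟩, ⟨hab.2.1, h.tail hab⟩, hab.2.2⟩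
  have hsymm : Std.Symm (fun a b => a ∈ F ∧ b ∈ F ∧ (a ∩ b).card = 2) :=
    ⟨fun a b h => ⟨h.2.1, h.1, by rw [Finset.inter_comm]; exact h.2.2⟩⟩
  refine ⟨F, ⟨⟨e, heF⟩, ⟨fun f hf => hf.1, fun f hf f' hf' => ?_⟩, ?_⟩, heF⟩
  · refine Relation.ReflTransGen.trans ?_ (by convert key f' hf'.2)
    have := Relation.ReflTransGen.stdSymm.symm _ _ (key f hf.2)
    convert this
  · rintro F' ⟨hF'H, hF'⟩ hFF' f hf
    refine ⟨hF'H hf, ?_⟩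
    refine Relation.ReflTransGen.mono (fun a b hab => ?_) e f (hF' e (hFF' heF) f hf)
    refine ⟨hF'H hab.1, hF'H hab.2.1, ?_⟩
    convert hab.2.2

/-- With fewer than two components a set is repeated or empty, so that the later case analysis
always handles exactly two sets. -/
theorem exists_edges_eq_union {V : Type*} (H : ThreeGraph V)
    (hH : H.tightComponents.encard ≤ 2) :
    ∃ T₁ T₂, TightlyConnected T₁ ∧ TightlyConnected T₂ ∧ H.edges = T₁ ∪ T₂ := by
  have htc : ∀ F ∈ H.tightComponents, F ⊆ H.edges ∧ TightlyConnected F := fun F hF => hF.2.1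
  by_cases h1 : ∃ T₁, T₁ ∈ H.tightComponents
  · obtain ⟨T₁, hT₁⟩ := h1
    by_cases h2 : ∃ T₂ ∈ H.tightComponents, T₁ ≠ T₂
    · obtain ⟨T₂, hT₂, hne⟩ := h2
      refine ⟨T₁, T₂, (htc _ hT₁).2, (htc _ hT₂).2, subset_antisymm (fun e he => ?_)
        (Set.union_subset (htc _ hT₁).1 (htc _ hT₂).1)⟩
      obtain ⟨F, hF, heF⟩ := H.exists_mem_tightComponents he
      by_contra hcon
      have hF1 : T₁ ≠ F := fun h => hcon (Or.inl (h ▸ heF))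
      have hF2 : T₂ ≠ F := fun h => hcon (Or.inr (h ▸ heF))
      have hle : ({T₁, T₂, F} : Set (Set (Finset V))).encard ≤ H.tightComponents.encard :=
        Set.encard_le_encard (by
          rintro x (rfl | rfl | rfl)
          exacts [hT₁, hT₂, hF])
      rw [Set.encard_eq_three.2 ⟨T₁, T₂, F, hne, hF1, hF2, rfl⟩] at hle
      exact absurd (hle.trans hH) (by decide)
    · push Not at h2
      refine ⟨T₁, T₁, (htc _ hT₁).2, (htc _ hT₁).2, subset_antisymm (fun e he => ?_)
        (Set.union_subset (htc _ hT₁).1 (htc _ hT₁).1)⟩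
      obtain ⟨F, hF, heF⟩ := H.exists_mem_tightComponents he
      exact Or.inl (h2 F hF ▸ heF)
  · refine ⟨∅, ∅, tightlyConnected_empty, tightlyConnected_empty, subset_antisymm
      (fun e he => ?_) (by simp)⟩
    obtain ⟨F, hF, -⟩ := H.exists_mem_tightComponents he
    exact (h1 ⟨F, hF⟩).elim

/-- Every union of two tightly connected sets of edges on `V` with a homomorphism to `G` is
iterated tripartite. -/
def HomsIteratedTripartite (V : Type*) {W : Type*} [DecidableEq W] (G : ThreeGraph W) : Prop :=
  ∀ (H : ThreeGraph V) (T₁ T₂ : Set (Finset V)), TightlyConnected T₁ → TightlyConnected T₂ →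
    H.edges = T₁ ∪ T₂ → ∀ g : V → W, (∀ e ∈ H.edges, e.image g ∈ G.edges) →
    H.IsIteratedTripartite

/-! ### Copies of a `3`-graph joined by a coloring of pairs -/

/-- `m` disjoint copies of `G`, together with the triples of vertices from distinct copies such that
`χ` assigns to each pair in the triple the index of the copy of the remaining vertex. -/
def joinCopies {W : Type*} [DecidableEq W] {m : ℕ} (G : ThreeGraph W)
    (χ : Finset (Fin m × W) → Fin m) : ThreeGraph (Fin m × W) where
  edges := {e | e.card = 3 ∧
    ((Set.InjOn Prod.fst (e : Set (Fin m × W)) ∧ ∀ w ∈ e, χ (e.erase w) = w.1) ∨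
      ((∃ i, ∀ w ∈ e, w.1 = i) ∧ e.image Prod.snd ∈ G.edges))}
  card_eq := fun _ he => he.1

theorem exists_eq_insert_pair {α : Type*} [DecidableEq α] {e : Finset α} (he : e.card = 3)
    {u v : α} (huv : u ≠ v) (hu : u ∈ e) (hv : v ∈ e) :
    ∃ w ∈ e, e.erase w = {u, v} ∧ e = insert w {u, v} := by
  have hsub : ({u, v} : Finset α) ⊆ e := by
    intro x hx
    rcases Finset.mem_insert.1 hx with rfl | hx
    · exact hu
    · rwa [Finset.mem_singleton.1 hx]
  have hc : (e \ {u, v}).card = 1 := by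
    rw [Finset.card_sdiff_of_subset hsub, he, Finset.card_pair huv]
  obtain ⟨w, hw⟩ := Finset.card_eq_one.1 hc
  have hwe : w ∈ e \ {u, v} := hw ▸ Finset.mem_singleton_self w
  have hins : e = insert w {u, v} := by
    rw [← Finset.sdiff_union_of_subset hsub, hw]
    rfl
  refine ⟨w, (Finset.mem_sdiff.1 hwe).1, ?_, hins⟩
  conv_lhs => rw [hins]
  exact Finset.erase_insert (Finset.mem_sdiff.1 hwe).2

/-- The pair `u, v` fixes the copy of the third vertex: it is the color of the pair if `u` and `v`
lie in distinct copies, and their common copy otherwise. This is the reason for the coloring rule.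
-/
theorem image_fst_eq_of_mem_joinCopies {W : Type*} [DecidableEq W] {m : ℕ} {G : ThreeGraph W}
    {χ : Finset (Fin m × W) → Fin m} {e f : Finset (Fin m × W)}
    (he : e ∈ (G.joinCopies χ).edges) (hf : f ∈ (G.joinCopies χ).edges) {u v : Fin m × W}
    (huv : u ≠ v) (hue : u ∈ e) (huf : u ∈ f) (hve : v ∈ e) (hvf : v ∈ f) :
    e.image Prod.fst = f.image Prod.fst := by
  obtain ⟨w, hw, hew, hei⟩ := exists_eq_insert_pair he.1 huv hue hve
  obtain ⟨x, hx, hfx, hfi⟩ := exists_eq_insert_pair hf.1 huv huf hvf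
  have hwx : w.1 = x.1 := by
    rcases he.2 with ⟨hinj, hχ⟩ | ⟨⟨i, hi⟩, -⟩
    · rcases hf.2 with ⟨-, hχ'⟩ | ⟨⟨i', hi'⟩, -⟩
      · rw [← hχ w hw, ← hχ' x hx, hew, hfx]
      · exact (huv (hinj hue hve ((hi' u huf).trans (hi' v hvf).symm))).elim
    · rcases hf.2 with ⟨hinj, -⟩ | ⟨⟨i', hi'⟩, -⟩
      · exact (huv (hinj huf hvf ((hi u hue).trans (hi v hve).symm))).elim
      · rw [hi w hw, hi' x hx, ← hi u hue, ← hi' u huf]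
  rw [hei, hfi, Finset.image_insert, Finset.image_insert (a := x), hwx]

/-- A tightly connected set of edges with a homomorphism to `G.joinCopies χ` is mapped into one
copy of `G`, or its edges are mapped to triples with one vertex in each of three fixed copies. -/
theorem TightlyConnected.joinCopies_cases {V W : Type*} [DecidableEq W] {m : ℕ} [NeZero m]
    {G : ThreeGraph W} {χ : Finset (Fin m × W) → Fin m} {T : Set (Finset V)}
    (hT : TightlyConnected T) (hc : ∀ e ∈ T, e.card = 3) {g : V → Fin m × W}
    (hg : ∀ e ∈ T, e.image g ∈ (G.joinCopies χ).edges) :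
    (∃ i, ∀ e ∈ T, (∀ v ∈ e, (g v).1 = i) ∧ e.image (fun v => (g v).2) ∈ G.edges) ∨
      ∃ L : Finset (Fin m), L.card = 3 ∧
        ∀ e ∈ T, Set.InjOn (fun v => (g v).1) e ∧ ∀ v ∈ e, (g v).1 ∈ L := by
  rcases T.eq_empty_or_nonempty with rfl | ⟨e₀, he₀⟩
  -- An empty set of edges counts as lying in an arbitrary copy, which exists by `NeZero m`.
  · exact Or.inl ⟨0, fun e he => he.elim⟩
  have hinj : ∀ e ∈ T, Set.InjOn g e := fun e he =>
    Finset.card_image_iff.1 ((hg e he).1.trans (hc e he).symm)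
  have hconst : ∀ e ∈ T, (e.image g).image Prod.fst = (e₀.image g).image Prod.fst := by
    intro e he
    refine hT.apply_eq (fun e => (e.image g).image Prod.fst) ?_ he he₀
    intro e he f hf u v huv hue huf hve hvf
    exact image_fst_eq_of_mem_joinCopies (hg e he) (hg f hf)
      (fun h => huv (hinj e he hue hve h)) (Finset.mem_image_of_mem g hue)
      (Finset.mem_image_of_mem g huf) (Finset.mem_image_of_mem g hve)
      (Finset.mem_image_of_mem g hvf)
  have hmem : ∀ e ∈ T, ∀ v ∈ e, (g v).1 ∈ (e₀.image g).image Prod.fst := fun e he v hv => by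
    rw [← hconst e he]
    exact Finset.mem_image_of_mem _ (Finset.mem_image_of_mem _ hv)
  rcases (hg e₀ he₀).2 with ⟨h0, -⟩ | ⟨⟨i, hi⟩, -⟩
  · have h3 : ((e₀.image g).image Prod.fst).card = 3 := by
      rw [Finset.card_image_of_injOn h0, (hg e₀ he₀).1]
    refine Or.inr ⟨_, h3, fun e he => ⟨?_, hmem e he⟩⟩
    refine Finset.card_image_iff.1 ?_
    have := hconst e he
    rw [Finset.image_image] at this
    rw [hc e he, ← h3, ← this]
    rfl
  · have hall : ∀ e ∈ T, ∀ v ∈ e, (g v).1 = i := by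
      intro e he v hv
      obtain ⟨w, hw, hwv⟩ := Finset.mem_image.1 (hmem e he v hv)
      rw [← hwv]
      exact hi w hw
    refine Or.inl ⟨i, fun e he => ⟨hall e he, ?_⟩⟩
    rcases (hg e he).2 with ⟨h, -⟩ | ⟨-, h⟩
    · exfalso
      have : 1 < e.card := by rw [hc e he]; omega
      obtain ⟨a, ha, b, hb, hab⟩ := Finset.one_lt_card.1 this
      have hcoe : ∀ v ∈ e, g v ∈ ((e.image g : Finset (Fin m × W)) : Set (Fin m × W)) :=
        fun v hv => Finset.mem_coe.2 (Finset.mem_image_of_mem g hv)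
      exact hab (hinj e he ha hb (h (hcoe a ha) (hcoe b hb)
        ((hall e he a ha).trans (hall e he b hb).symm)))
    · rwa [Finset.image_image] at h

/-- Any two sets of size three can be colored with three colors such that both are rainbow. -/
theorem exists_injOn_injOn {α : Type*} {L₁ L₂ : Finset α} (h₁ : L₁.card = 3)
    (h₂ : L₂.card = 3) :
    ∃ c : α → Fin 3, Set.InjOn c L₁ ∧ Set.InjOn c L₂ := by
  classical
  obtain ⟨c₁, hc₁⟩ : ∃ c : α → Fin 3, Set.InjOn c L₁ := by
    let E := L₁.equivFinOfCardEq h₁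
    refine ⟨fun x => if h : x ∈ L₁ then E ⟨x, h⟩ else 0, fun x hx y hy hxy => ?_⟩
    simp only [Finset.mem_coe] at hx hy
    simp only [hx, hy, dif_pos] at hxy
    exact congrArg Subtype.val (E.injective hxy)
  -- The coloring of `L₁` is injective on `L₁ ∩ L₂`, hence extends to a bijection from `L₂` to the
  -- colors.
  obtain ⟨E, hE⟩ := Finset.exists_equiv_extend_of_card_eq (α := L₂)
    (t := (Finset.univ : Finset (Fin 3))) (by simp [h₂])
    (s := Finset.univ.filter fun x : L₂ => (x : α) ∈ L₁) (f := fun x => c₁ x)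
    (Finset.subset_univ _) (fun x hx y hy hxy => Subtype.ext
      (hc₁ (Finset.mem_filter.1 hx).2 (Finset.mem_filter.1 hy).2 hxy))
  refine ⟨fun x => if h : x ∈ L₂ then (E ⟨x, h⟩ : Fin 3) else c₁ x, ?_, ?_⟩
  · have heq : ∀ x ∈ L₁, (if h : x ∈ L₂ then (E ⟨x, h⟩ : Fin 3) else c₁ x) = c₁ x := by
      intro x hx
      split_ifs with h
      · exact hE ⟨x, h⟩ (by simpa using hx)
      · rfl
    intro x hx y hy hxy
    simp only [heq x hx, heq y hy] at hxy
    exact hc₁ hx hy hxy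
  · intro x hx y hy hxy
    simp only [Finset.mem_coe] at hx hy
    simp only [hx, hy, dif_pos] at hxy
    exact congrArg Subtype.val (E.injective (Subtype.ext hxy))

/-- Each of the two sets is confined to one copy or spread over three. Spread sets become
transversal under a 3-coloring of the copies; confined ones go inside a part by the hypothesis on
`G`, applied to both sets together if they share a copy. -/
theorem HomsIteratedTripartite.joinCopies {V W : Type*} [Finite V] [DecidableEq W] {m : ℕ}
    [NeZero m] {G : ThreeGraph W} (hG : HomsIteratedTripartite V G)
    (χ : Finset (Fin m × W) → Fin m) : HomsIteratedTripartite V (G.joinCopies χ) := by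
  classical
  intro H T₁ T₂ hT₁ hT₂ hH g hg
  have hs₁ : T₁ ⊆ H.edges := hH ▸ Set.subset_union_left
  have hs₂ : T₂ ⊆ H.edges := hH ▸ Set.subset_union_right
  have hcase₁ := hT₁.joinCopies_cases (fun e he => H.card_eq e (hs₁ he))
    (fun e he => hg e (hs₁ he))
  have hcase₂ := hT₂.joinCopies_cases (fun e he => H.card_eq e (hs₂ he))
    (fun e he => hg e (hs₂ he))
  have hsingle : ∀ T, TightlyConnected T → ∀ hT : T ⊆ H.edges,
      (∀ e ∈ T, e.image (fun v => (g v).2) ∈ G.edges) →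
      (⟨T, fun e he => H.card_eq e (hT he)⟩ : ThreeGraph V).IsIteratedTripartite :=
    fun T hT _ h => hG _ T ∅ hT tightlyConnected_empty (Set.union_empty T).symm _ h
  -- one set of edges is spread over three copies, the other one lies in a single copy
  have hmixed : ∀ T T', T ⊆ H.edges → TightlyConnected T' → ∀ hT' : T' ⊆ H.edges,
      H.edges = T ∪ T' → ∀ (L : Finset (Fin m)), L.card = 3 →
      (∀ e ∈ T, Set.InjOn (fun v => (g v).1) e ∧ ∀ v ∈ e, (g v).1 ∈ L) →
      ∀ i, (∀ e ∈ T', (∀ v ∈ e, (g v).1 = i) ∧ e.image (fun v => (g v).2) ∈ G.edges) →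
      H.IsIteratedTripartite := by
    intro T T' _ hT' hs' hU L hL h i h'
    obtain ⟨c, hc, -⟩ := exists_injOn_injOn hL hL
    refine isIteratedTripartite_of_classes (fun v => c (g v).1)
      (fun _ => ⟨T', fun e he => H.card_eq e (hs' he)⟩)
      (fun _ => hsingle T' hT' hs' fun e he => (h' e he).2) fun e he => ?_
    rw [hU] at he
    rcases he with he | he
    · exact Or.inl fun x hx y hy hxy =>
        (h e he).1 hx hy (hc ((h e he).2 x hx) ((h e he).2 y hy) hxy)
    · exact Or.inr ⟨c i, fun v hv => by rw [(h' e he).1 v hv], he⟩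
  rcases hcase₁ with ⟨i, hi⟩ | ⟨L, hL, h₁⟩ <;> rcases hcase₂ with ⟨j, hj⟩ | ⟨M, hM, h₂⟩
  · rcases eq_or_ne i j with rfl | hij
    · refine hG H T₁ T₂ hT₁ hT₂ hH (fun v => (g v).2) fun e he => ?_
      rw [hH] at he
      exact he.elim (fun h => (hi e h).2) fun h => (hj e h).2
    · refine isIteratedTripartite_of_classes (fun v => if (g v).1 = i then 0 else 1)
        (fun t => if t = 0 then ⟨T₁, fun e he => H.card_eq e (hs₁ he)⟩
          else ⟨T₂, fun e he => H.card_eq e (hs₂ he)⟩) (fun t => ?_) fun e he => Or.inr ?_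
      · split_ifs
        · exact hsingle T₁ hT₁ hs₁ fun e he => (hi e he).2
        · exact hsingle T₂ hT₂ hs₂ fun e he => (hj e he).2
      · rw [hH] at he
        rcases he with he | he
        · exact ⟨0, fun v hv => by simp [(hi e he).1 v hv], by simpa using he⟩
        · exact ⟨1, fun v hv => by simp [(hj e he).1 v hv, hij.symm], by simpa using he⟩
  · exact hmixed T₂ T₁ hs₂ hT₁ hs₁ (by rw [hH, Set.union_comm]) M hM h₂ i hi
  · exact hmixed T₁ T₂ hs₁ hT₂ hs₂ hH L hL h₁ j hj
  · obtain ⟨c, hc₁, hc₂⟩ := exists_injOn_injOn hL hM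
    refine isIteratedTripartite_of_classes (fun v => c (g v).1) (fun _ => edgeless V)
      (fun _ => isIteratedTripartite_of_edges_eq_empty rfl) fun e he => Or.inl ?_
    rw [hH] at he
    rcases he with he | he
    · exact fun x hx y hy hxy =>
        (h₁ e he).1 hx hy (hc₁ ((h₁ e he).2 x hx) ((h₁ e he).2 y hy) hxy)
    · exact fun x hx y hy hxy =>
        (h₂ e he).1 hx hy (hc₂ ((h₂ e he).2 x hx) ((h₂ e he).2 y hy) hxy)

/-! ### Random colorings of pairs -/

/-- The number of colorings that differ from a given pattern on each of some disjoint triples. -/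
theorem card_avoiding_mul_le {ι Q : Type*} [Fintype ι] [DecidableEq ι] [Fintype Q] {m : ℕ}
    (b : Q × Fin 3 → ι) (hb : Function.Injective b) (t : Fin 3 → Fin m) :
    (Finset.univ.filter fun χ : ι → Fin m => ∀ q, ∃ j, χ (b (q, j)) ≠ t j).card *
        (m ^ 3) ^ Fintype.card Q ≤
      (m ^ 3 - 1) ^ Fintype.card Q * m ^ Fintype.card ι := by
  classical
  have hle : 3 * Fintype.card Q ≤ Fintype.card ι := by
    have := Fintype.card_le_of_injective b hb
    rwa [Fintype.card_prod, Fintype.card_fin, mul_comm] at this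
  -- A coloring is encoded by its patterns on the disjoint triples, each different from `t`, and its
  -- values elsewhere.
  have hinj : (Finset.univ.filter fun χ : ι → Fin m => ∀ q, ∃ j, χ (b (q, j)) ≠ t j).card ≤
      Fintype.card ((Q → {f : Fin 3 → Fin m // f ≠ t}) × ({x // x ∉ Set.range b} → Fin m)) := by
    rw [← Fintype.card_coe]
    refine Fintype.card_le_of_injective (fun χ => (fun q => ⟨fun j => χ.1 (b (q, j)), fun h => ?_⟩,
      fun x => χ.1 x)) ?_
    · obtain ⟨j, hj⟩ := (Finset.mem_filter.1 χ.2).2 q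
      exact hj (congrFun h j)
    · rintro ⟨χ, h⟩ ⟨χ', h'⟩ heq
      simp only [Prod.mk.injEq] at heq
      refine Subtype.ext (funext fun x => ?_)
      by_cases hx : x ∈ Set.range b
      · obtain ⟨⟨q, j⟩, rfl⟩ := hx
        exact congrFun (congrArg Subtype.val (congrFun heq.1 q)) j
      · exact congrFun heq.2 ⟨x, hx⟩
  have hcard : Fintype.card {x // x ∉ Set.range b} = Fintype.card ι - 3 * Fintype.card Q := by
    rw [Fintype.card_subtype_compl]
    congr 1
    rw [← Fintype.card_congr (Equiv.ofInjective b hb), Fintype.card_prod, Fintype.card_fin,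
      mul_comm]
  have hne : Fintype.card {f : Fin 3 → Fin m // f ≠ t} = m ^ 3 - 1 := by
    rw [Fintype.card_subtype_compl]
    simp
  rw [Fintype.card_prod, Fintype.card_fun, Fintype.card_fun, hcard, hne, Fintype.card_fin] at hinj
  calc _ ≤ (m ^ 3 - 1) ^ Fintype.card Q * m ^ (Fintype.card ι - 3 * Fintype.card Q) *
        (m ^ 3) ^ Fintype.card Q := Nat.mul_le_mul_right _ hinj
    _ = (m ^ 3 - 1) ^ Fintype.card Q * m ^ Fintype.card ι := by
        rw [← pow_mul, mul_assoc, ← pow_add]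
        congr 2
        omega

/-- The triples `(a, b, a + b)`, any two entries of which determine the third one. -/
def additiveTriple {s : ℕ} [NeZero s] (q : Fin s × Fin s) : Fin 3 → Fin s :=
  ![q.1, q.2, q.1 + q.2]

theorem eq_of_additiveTriple {s : ℕ} [NeZero s] {q q' : Fin s × Fin s} {j : Fin 3}
    (h : ∀ k, k ≠ j → additiveTriple q k = additiveTriple q' k) : q = q' := by
  obtain ⟨a, b⟩ := q
  obtain ⟨a', b'⟩ := q'
  have h0 : j ≠ 0 → a = a' := fun hj => h 0 hj.symm
  have h1 : j ≠ 1 → b = b' := fun hj => h 1 hj.symm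
  have h2 : j ≠ 2 → a + b = a' + b' := fun hj => h 2 hj.symm
  fin_cases j
  · obtain rfl := h1 (by decide)
    rw [add_right_cancel (h2 (by decide))]
  · obtain rfl := h0 (by decide)
    rw [add_left_cancel (h2 (by decide))]
  · rw [h0 (by decide), h1 (by decide)]

/-- Some coloring of pairs provides an edge of `G.joinCopies χ` between any three sets of size `s`
in distinct copies. -/
theorem exists_coloring {W : Type*} [Fintype W] [DecidableEq W] {m s : ℕ} [NeZero s]
    (h : m ^ 3 * (Fintype.card W ^ s) ^ 3 * (m ^ 3 - 1) ^ (s * s) < (m ^ 3) ^ (s * s)) :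
    ∃ χ : Finset (Fin m × W) → Fin m, ∀ (i : Fin 3 → Fin m) (x : Fin 3 → Fin s → W),
      Function.Injective i → (∀ k, Function.Injective (x k)) →
      ∃ q, ∀ j, χ ((Finset.univ.image fun k => (i k, x k (additiveTriple q k))).erase
        (i j, x j (additiveTriple q j))) = i j := by
  classical
  set b : (Fin 3 → Fin m) × (Fin 3 → Fin s → W) → (Fin s × Fin s) × Fin 3 → Finset (Fin m × W) :=
    fun p r => (Finset.univ.image fun k => (p.1 k, p.2 k (additiveTriple r.1 k))).erase
      (p.1 r.2, p.2 r.2 (additiveTriple r.1 r.2)) with hb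
  set A : Finset ((Fin 3 → Fin m) × (Fin 3 → Fin s → W)) := Finset.univ.filter fun p =>
    Function.Injective p.1 ∧ ∀ k, Function.Injective (p.2 k) with hA
  -- A pair arising from `p` reveals `j` as the index it misses, and its two entries determine `q`.
  -- So the `s * s` candidate triples use disjoint sets of pairs and behave independently.
  have hbinj : ∀ p ∈ A, Function.Injective (b p) := by
    rintro ⟨i, x⟩ hp ⟨q, j⟩ ⟨q', j'⟩ heq
    obtain ⟨hi, hx⟩ := (Finset.mem_filter.1 hp).2
    have key : ∀ k, k ≠ j → k ≠ j' ∧ additiveTriple q k = additiveTriple q' k := by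
      intro k hk
      have hmem : (i k, x k (additiveTriple q k)) ∈ b (i, x) (q', j') := by
        rw [← heq]
        exact Finset.mem_erase.2 ⟨fun h => hk (hi (congrArg Prod.fst h)),
          Finset.mem_image_of_mem _ (Finset.mem_univ k)⟩
      obtain ⟨hne, himg⟩ := Finset.mem_erase.1 hmem
      obtain ⟨k', -, hk'⟩ := Finset.mem_image.1 himg
      obtain rfl : k' = k := hi (congrArg Prod.fst hk')
      have htri := (hx k' (congrArg Prod.snd hk')).symm
      refine ⟨?_, htri⟩
      rintro rfl
      exact hne (by rw [htri])
    obtain rfl : j = j' := by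
      by_contra hne
      exact (key j' (Ne.symm hne)).1 rfl
    rw [eq_of_additiveTriple fun k hk => (key k hk).2]
  by_contra! hcon
  set bad : (Fin 3 → Fin m) × (Fin 3 → Fin s → W) → Finset (Finset (Fin m × W) → Fin m) :=
    fun p => Finset.univ.filter fun χ => ∀ q, ∃ j, χ (b p (q, j)) ≠ p.1 j with hbad
  have hcover : (Finset.univ : Finset (Finset (Fin m × W) → Fin m)) ⊆ A.biUnion bad := by
    intro χ _
    obtain ⟨i, x, hi, hx, hq⟩ := hcon χ
    exact Finset.mem_biUnion.2 ⟨(i, x), Finset.mem_filter.2 ⟨Finset.mem_univ _, hi, hx⟩,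
      Finset.mem_filter.2 ⟨Finset.mem_univ _, hq⟩⟩
  have hAc : A.card ≤ m ^ 3 * (Fintype.card W ^ s) ^ 3 := by
    refine (Finset.card_le_univ A).trans_eq ?_
    simp
  set E := Fintype.card (Finset (Fin m × W)) with hE
  have h1 : m ^ E ≤ ∑ p ∈ A, (bad p).card := by
    refine le_trans (Eq.le ?_) ((Finset.card_le_card hcover).trans Finset.card_biUnion_le)
    rw [Finset.card_univ, Fintype.card_fun, Fintype.card_fin]
  have h2 : m ^ E * (m ^ 3) ^ (s * s) ≤ A.card * ((m ^ 3 - 1) ^ (s * s) * m ^ E) := by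
    refine (Nat.mul_le_mul_right _ h1).trans ?_
    rw [Finset.sum_mul, ← smul_eq_mul (a := A.card)]
    refine Finset.sum_le_card_nsmul _ _ _ fun p hp => ?_
    have := card_avoiding_mul_le (b p) (hbinj p hp) p.1
    rwa [Fintype.card_prod, Fintype.card_fin] at this
  have hm : 0 < m := by
    rcases Nat.eq_zero_or_pos m with rfl | hm
    · have : s * s ≠ 0 := mul_ne_zero (NeZero.ne s) (NeZero.ne s)
      simp [this] at h
    · exact hm
  have h3 : m ^ E * (m ^ 3) ^ (s * s) ≤
      m ^ E * (m ^ 3 * (Fintype.card W ^ s) ^ 3 * (m ^ 3 - 1) ^ (s * s)) := by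
    refine h2.trans ((Nat.mul_le_mul_right _ hAc).trans_eq ?_)
    ring
  exact absurd (Nat.le_of_mul_le_mul_left h3 (Nat.pow_pos hm)) (not_le.2 h)

/-- If every `n`-set of vertices of `G` spans an edge, then so does every `3 * n`-set in a suitable
`G.joinCopies χ`. -/
theorem exists_edge_subset_joinCopies {W : Type*} [Fintype W] [DecidableEq W] {m n s : ℕ}
    [NeZero s] {G : ThreeGraph W} (hG : ∀ S : Finset W, S.card = n → ∃ e ∈ G.edges, e ⊆ S)
    (hm : 0 < m) (hsm : s * m ≤ n) {χ : Finset (Fin m × W) → Fin m}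
    (hχ : ∀ (i : Fin 3 → Fin m) (x : Fin 3 → Fin s → W),
      Function.Injective i → (∀ k, Function.Injective (x k)) →
      ∃ q, ∀ j, χ ((Finset.univ.image fun k => (i k, x k (additiveTriple q k))).erase
        (i j, x j (additiveTriple q j))) = i j)
    (S : Finset (Fin m × W)) (hS : S.card = 3 * n) :
    ∃ e ∈ (G.joinCopies χ).edges, e ⊆ S := by
  classical
  have hs : 0 < s := Nat.pos_of_ne_zero (NeZero.ne s)
  set F : Fin m → Finset W := fun i => Finset.univ.filter fun w => (i, w) ∈ S with hF
  have hFS : ∀ i w, w ∈ F i → (i, w) ∈ S := fun i w hw => (Finset.mem_filter.1 hw).2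
  by_cases hbig : ∃ i, n ≤ (F i).card
  · obtain ⟨i, hi⟩ := hbig
    obtain ⟨S', hS', hS'c⟩ := Finset.exists_subset_card_eq hi
    obtain ⟨e, he, heS⟩ := hG S' hS'c
    refine ⟨e.map (Function.Embedding.sectR i W), ⟨?_, Or.inr ⟨⟨i, ?_⟩, ?_⟩⟩, ?_⟩
    · rw [Finset.card_map, G.card_eq e he]
    · intro w hw
      obtain ⟨x, -, rfl⟩ := Finset.mem_map.1 hw
      rfl
    · rw [Finset.map_eq_image, Finset.image_image]
      convert he
      exact Finset.image_id
    · intro w hw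
      obtain ⟨x, hx, rfl⟩ := Finset.mem_map.1 hw
      exact hFS i x (hS' (heS hx))
  push Not at hbig
  set B := Finset.univ.filter fun i => s ≤ (F i).card with hB
  -- Otherwise at most two copies contain fewer than `n` vertices of `S` each, and the rest at most
  -- `s - 1` each, for a total below `2 * n + s * m ≤ 3 * n`.
  have hB3 : 3 ≤ B.card := by
    by_contra! hlt
    have hsum : S.card = ∑ i, (F i).card := by
      rw [Finset.card_eq_sum_card_fiberwise (f := Prod.fst) (t := Finset.univ)
        (fun _ _ => Finset.mem_univ _)]
      refine Finset.sum_congr rfl fun i _ => ?_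
      refine (Finset.card_bij (fun w _ => (i, w)) ?_ ?_ ?_).symm
      · intro w hw
        exact Finset.mem_filter.2 ⟨hFS i w hw, rfl⟩
      · intro w _ w' _ h
        exact congrArg Prod.snd h
      · rintro ⟨i', w⟩ hw
        obtain ⟨hwS, h⟩ := Finset.mem_filter.1 hw
        obtain rfl : i' = i := h
        exact ⟨w, Finset.mem_filter.2 ⟨Finset.mem_univ _, hwS⟩, rfl⟩
    have h1 : ∑ i ∈ B, (F i).card ≤ 2 * n := by
      refine (Finset.sum_le_card_nsmul _ _ n fun i _ => (hbig i).le).trans ?_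
      exact Nat.mul_le_mul_right _ (by omega)
    have h2 : ∑ i ∈ Finset.univ.filter (fun i => ¬ s ≤ (F i).card), (F i).card ≤ m * (s - 1) := by
      refine (Finset.sum_le_card_nsmul _ _ (s - 1) fun i hi => ?_).trans ?_
      · have := (Finset.mem_filter.1 hi).2
        omega
      · refine Nat.mul_le_mul_right _ ((Finset.card_le_univ _).trans_eq ?_)
        rw [Fintype.card_fin]
    have h4 : ∑ i ∈ B, (F i).card +
        ∑ i ∈ Finset.univ.filter (fun i => ¬ s ≤ (F i).card), (F i).card = ∑ i, (F i).card :=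
      Finset.sum_filter_add_sum_filter_not _ _ _
    have h3 : m * (s - 1) < n := by
      refine lt_of_lt_of_le ?_ hsm
      rw [mul_comm s]
      exact Nat.mul_lt_mul_of_pos_left (by omega) hm
    omega
  obtain ⟨B', hB', hB'c⟩ := Finset.exists_subset_card_eq hB3
  let ε := (B'.equivFinOfCardEq hB'c).symm
  have hx : ∀ k : Fin 3, ∃ x : Fin s → W, Function.Injective x ∧ ∀ a, x a ∈ F (ε k) := by
    intro k
    have hk := (Finset.mem_filter.1 (hB' (ε k).2)).2
    obtain ⟨Y, hY, hYc⟩ := Finset.exists_subset_card_eq hk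
    exact ⟨fun a => (Y.equivFinOfCardEq hYc).symm a,
      Subtype.val_injective.comp (Equiv.injective _), fun a => hY (Subtype.prop _)⟩
  choose x hxinj hxF using hx
  have hε : Function.Injective fun k => (ε k : Fin m) :=
    Subtype.val_injective.comp ε.injective
  obtain ⟨q, hq⟩ := hχ (fun k => ε k) x hε hxinj
  refine ⟨Finset.univ.image fun k => ((ε k : Fin m), x k (additiveTriple q k)),
    ⟨?_, Or.inl ⟨?_, ?_⟩⟩, ?_⟩
  · rw [Finset.card_image_of_injective _ fun k k' h => hε (congrArg Prod.fst h)]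
    rfl
  · intro y hy z hz hyz
    obtain ⟨k, -, rfl⟩ := Finset.mem_image.1 (Finset.mem_coe.1 hy)
    obtain ⟨k', -, rfl⟩ := Finset.mem_image.1 (Finset.mem_coe.1 hz)
    rw [hε hyz]
  · intro w hw
    obtain ⟨k, -, rfl⟩ := Finset.mem_image.1 hw
    exact hq k
  · intro w hw
    obtain ⟨k, -, rfl⟩ := Finset.mem_image.1 hw
    exact hFS _ _ (hxF k _)

/-! ### The lower bound -/

theorem pow_succ_add_le (a n : ℕ) : a ^ (n + 1) + (n + 1) * a ^ n ≤ (a + 1) ^ (n + 1) := by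
  induction n with
  | zero => simp
  | succ n ih =>
    calc a ^ (n + 1 + 1) + (n + 1 + 1) * a ^ (n + 1)
        ≤ (a ^ (n + 1) + (n + 1) * a ^ n) * (a + 1) := by
          have : 0 ≤ (n + 1) * a ^ n := Nat.zero_le _
          ring_nf
          ring_nf at this
          omega
      _ ≤ (a + 1) ^ (n + 1) * (a + 1) := Nat.mul_le_mul_right _ ih

/-- An integer form of `(1 - 1 / M) ^ M ≤ 1 / 2`: each of the first two binomial terms of `(a + 1) ^
(a + 1)` is at least `a ^ (a + 1)`. -/
theorem two_mul_pred_pow_le {M : ℕ} (hM : 0 < M) : 2 * (M - 1) ^ M ≤ M ^ M := by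
  obtain ⟨a, rfl⟩ : ∃ a, M = a + 1 := ⟨M - 1, by omega⟩
  have h := pow_succ_add_le a a
  have : a ^ (a + 1) ≤ (a + 1) * a ^ a := by
    rw [pow_succ, mul_comm]
    exact Nat.mul_le_mul_right _ (Nat.le_succ a)
  simp only [Nat.add_sub_cancel]
  omega

/-- The hypothesis of `exists_coloring` for `m = 2 ^ t`, `s = 2 ^ (8 * t)` and `2 ^ (t * k)`
vertices per copy. Since `s * s = M * r` with `r = 2 ^ (13 * t)`, the failure probability is at most
`2 ^ (-r)`, while there are only `2 ^ O(t * k * s)` configurations. -/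
theorem union_bound_lt {t k : ℕ} (ht : 1 ≤ t) (hk : k ≤ t) :
    (2 ^ t) ^ 3 * ((2 ^ (t * k)) ^ 2 ^ (8 * t)) ^ 3 *
        ((2 ^ t) ^ 3 - 1) ^ (2 ^ (8 * t) * 2 ^ (8 * t)) <
      ((2 ^ t) ^ 3) ^ (2 ^ (8 * t) * 2 ^ (8 * t)) := by
  set M := (2 ^ t) ^ 3 with hM
  have hM2 : 2 ≤ M := by
    rw [hM, ← pow_mul]
    exact (pow_le_pow_right₀ (by norm_num) (by omega : 1 ≤ t * 3)).trans_eq' (by norm_num)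
  set r := 2 ^ (13 * t) with hr
  have hss : 2 ^ (8 * t) * 2 ^ (8 * t) = M * r := by
    rw [hM, hr, ← pow_mul, ← pow_add, ← pow_add]
    congr 1
    ring
  have h1 : 2 ^ r * (M - 1) ^ (M * r) ≤ M ^ (M * r) := by
    rw [pow_mul, pow_mul, ← mul_pow]
    exact Nat.pow_le_pow_left (two_mul_pred_pow_le (by omega)) _
  have h2 : t * 3 + t * k * 2 ^ (8 * t) * 3 < r := by
    have ht2 : t < 2 ^ t := Nat.lt_two_pow_self
    have hs1 : 1 ≤ 2 ^ (8 * t) := Nat.one_le_two_pow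
    have h8 : 8 ≤ 2 ^ (3 * t) := by
      calc 8 = 2 ^ 3 := by norm_num
        _ ≤ 2 ^ (3 * t) := Nat.pow_le_pow_right (by norm_num) (by omega)
    have htt : t * t < 2 ^ (2 * t) := by
      rw [two_mul, pow_add]
      exact Nat.mul_lt_mul'' ht2 ht2
    have htk : t * k ≤ t * t := Nat.mul_le_mul_left _ hk
    have htt' : t ≤ t * t := Nat.le_mul_of_pos_left _ ht
    calc t * 3 + t * k * 2 ^ (8 * t) * 3
        ≤ t * t * 2 ^ (8 * t) * 3 + t * t * 2 ^ (8 * t) * 3 := by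
          refine Nat.add_le_add (Nat.mul_le_mul_right _ ?_)
            (Nat.mul_le_mul_right _ (Nat.mul_le_mul_right _ htk))
          exact htt'.trans (Nat.le_mul_of_pos_right _ hs1)
      _ = (t * t * 6) * 2 ^ (8 * t) := by ring
      _ < (2 ^ (2 * t) * 2 ^ (3 * t)) * 2 ^ (8 * t) := by
          refine Nat.mul_lt_mul_of_pos_right ?_ hs1
          exact Nat.mul_lt_mul_of_lt_of_le htt (by omega) (by omega)
      _ = r := by
          rw [hr, ← pow_add, ← pow_add]
          congr 1
          ring
  have h3 : M * ((2 ^ (t * k)) ^ 2 ^ (8 * t)) ^ 3 < 2 ^ r := by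
    rw [hM, ← pow_mul, ← pow_mul, ← pow_mul, ← pow_add, ← mul_assoc]
    exact Nat.pow_lt_pow_right (by norm_num) h2
  rw [hss]
  exact (Nat.mul_lt_mul_of_pos_right h3 (Nat.pow_pos (by omega))).trans_le h1

theorem exists_homsIteratedTripartite (V : Type*) [Finite V] {t : ℕ} (ht : 1 ≤ t) (k : ℕ)
    (hk : k ≤ t) :
    ∃ (W : Type) (_ : Fintype W) (_ : DecidableEq W) (G : ThreeGraph W),
      HomsIteratedTripartite V G ∧ Fintype.card W = 2 ^ (t * k) ∧
      ∀ S : Finset W, S.card = 3 ^ k * 2 ^ (9 * t) → ∃ e ∈ G.edges, e ⊆ S := by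
  induction k with
  | zero =>
    refine ⟨Unit, inferInstance, inferInstance, edgeless Unit, ?_, by simp, fun S hS => ?_⟩
    · intro H _ _ _ _ _ g hg
      exact isIteratedTripartite_of_edges_eq_empty
        (Set.eq_empty_of_forall_notMem fun e he => hg e he)
    -- Vacuous: one vertex has no subset of the required size.
    · have h1 : S.card ≤ 1 := S.card_le_univ
      have h2 : 1 < 2 ^ (9 * t) := Nat.one_lt_two_pow (by omega)
      omega
  | succ k ih =>
    obtain ⟨W, _, _, G, hG, hW, hα⟩ := ih (by omega)
    have : NeZero (2 ^ (8 * t)) := ⟨by positivity⟩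
    have : NeZero (2 ^ t) := ⟨by positivity⟩
    obtain ⟨χ, hχ⟩ := exists_coloring (W := W) (m := 2 ^ t) (s := 2 ^ (8 * t))
      (by rw [hW]; exact union_bound_lt ht (by omega))
    refine ⟨Fin (2 ^ t) × W, inferInstance, inferInstance, G.joinCopies χ, hG.joinCopies χ, ?_,
      fun S hS => ?_⟩
    · rw [Fintype.card_prod, hW, Fintype.card_fin, ← pow_add]
      congr 1
      ring
    · refine exists_edge_subset_joinCopies hα (by positivity) ?_ hχ S (by rw [hS]; ring)
      calc 2 ^ (8 * t) * 2 ^ t = 1 * 2 ^ (9 * t) := by rw [← pow_add, one_mul]; congr 1; ring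
        _ ≤ 3 ^ k * 2 ^ (9 * t) := Nat.mul_le_mul_right _ (Nat.one_le_pow _ _ (by norm_num))

/-- The lower bound on the off-diagonal Ramsey number of a `3`-graph with at most two tight
components which is not iterated tripartite. -/
theorem two_pow_sq_lt_ramseyNumber {V : Type*} [Finite V] {H : ThreeGraph V}
    (hH : H.tightComponents.encard ≤ 2) (hIT : ¬ H.IsIteratedTripartite) {t n : ℕ} (ht : 1 ≤ t)
    (hn : 2 ^ (11 * t) ≤ n) : 2 ^ (t * t) < H.ramseyNumber n := by
  classical
  obtain ⟨T₁, T₂, hT₁, hT₂, hU⟩ := H.exists_edges_eq_union hH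
  obtain ⟨W, _, _, G, hG, hW, hα⟩ := exists_homsIteratedTripartite V ht t le_rfl
  by_contra! hle
  have hcard : Fintype.card (Fin (H.ramseyNumber n)) ≤ Fintype.card W := by
    rwa [hW, Fintype.card_fin]
  obtain ⟨φ⟩ := Function.Embedding.nonempty_of_card_le hcard
  -- The red edges are those of the construction, pulled back along an embedding of the
  -- `H.ramseyNumber n` vertices.
  rcases H.ramseyNumber_spec n ⟨{e | e.map φ ∈ G.edges}, fun e he => by
    rw [← G.card_eq _ he, Finset.card_map]⟩ with ⟨f, hf⟩ | ⟨f, hf⟩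
  · refine hIT (hG H T₁ T₂ hT₁ hT₂ hU (fun v => φ (f v)) fun e he => ?_)
    have := hf e he
    rw [Set.mem_ofPred_eq, Finset.map_map, Finset.map_eq_image] at this
    exact this
  · have hsize : 3 ^ t * 2 ^ (9 * t) ≤ (Finset.univ.map (f.trans φ)).card := by
      rw [Finset.card_map, Finset.card_univ, Fintype.card_fin]
      refine le_trans ?_ hn
      calc 3 ^ t * 2 ^ (9 * t) ≤ 4 ^ t * 2 ^ (9 * t) :=
            Nat.mul_le_mul_right _ (Nat.pow_le_pow_left (by norm_num) t)
        _ = 2 ^ (11 * t) := by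
            rw [show 4 = 2 ^ 2 by norm_num, ← pow_mul, ← pow_add]
            congr 1
            ring
    obtain ⟨S, hS, hSc⟩ := Finset.exists_subset_card_eq hsize
    obtain ⟨e, he, heS⟩ := hα S hSc
    obtain ⟨e', -, rfl⟩ := Finset.subset_map_iff.1 (heS.trans hS)
    have he'c : e'.card = 3 := by rw [← G.card_eq _ he, Finset.card_map]
    refine (hf e' he'c).2 ?_
    rw [Set.mem_ofPred_eq, Finset.map_map]
    exact he

theorem le_ramseyNumber {V : Type*} [Finite V] {H : ThreeGraph V} (hH : H.edges.Nonempty)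
    (n : ℕ) : n ≤ H.ramseyNumber n := by
  rcases H.ramseyNumber_spec n (edgeless _) with ⟨f, hf⟩ | ⟨f, -⟩
  · obtain ⟨e, he⟩ := hH
    exact (hf e he).elim
  · simpa using Fintype.card_le_of_embedding f

theorem exists_two_rpow_le_ramseyNumber {V : Type*} [Finite V] {H : ThreeGraph V}
    (hH : H.tightComponents.encard ≤ 2) (hIT : ¬ H.IsIteratedTripartite) :
    ∃ c : ℝ, 0 < c ∧ ∀ n : ℕ, 1 ≤ n →
      (2 : ℝ) ^ (c * Real.log n ^ 2) ≤ (H.ramseyNumber n : ℝ) := by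
  -- Here `484 = 22 ^ 2`: for `n ≥ 2 ^ 11` some `t` has `2 ^ (11 * t) ≤ n < 2 ^ (22 * t)`, so `log n
  -- ≤ 22 * t`. Smaller `n` are covered by `le_ramseyNumber`.
  refine ⟨1 / 484, by norm_num, fun n hn => ?_⟩
  have hlog2 : Real.log 2 ≤ 1 := by linarith [Real.log_two_lt_d9]
  have hlog2' : 0 < Real.log 2 := Real.log_pos (by norm_num)
  have hn0 : (0 : ℝ) < n := by exact_mod_cast hn
  have hlogn : 0 ≤ Real.log n := Real.log_nonneg (by exact_mod_cast hn)
  rcases lt_or_ge n (2 ^ 11) with hsmall | hlarge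
  · have hne : H.edges.Nonempty := by
      by_contra h
      exact hIT (isIteratedTripartite_of_edges_eq_empty (Set.not_nonempty_iff_eq_empty.1 h))
    refine le_trans ?_ (Nat.cast_le.2 (le_ramseyNumber hne n))
    have h1 : Real.log n ≤ 11 := by
      have : Real.log n ≤ Real.log ((2 : ℝ) ^ 11) :=
        Real.log_le_log hn0 (by exact_mod_cast hsmall.le)
      rw [Real.log_pow] at this
      push_cast at this
      linarith
    rw [Real.rpow_def_of_pos (by norm_num), ← Real.le_log_iff_exp_le hn0]
    have h2 : 1 / 484 * Real.log n ≤ 1 := by linarith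
    calc Real.log 2 * (1 / 484 * Real.log n ^ 2)
        = Real.log 2 * ((1 / 484 * Real.log n) * Real.log n) := by ring
      _ ≤ 1 * (1 * Real.log n) := by gcongr
      _ = Real.log n := by ring
  · set L := Nat.log 2 n with hL
    have hLn : 2 ^ L ≤ n := Nat.pow_log_le_self 2 (by omega)
    have hnL : n < 2 ^ (L + 1) := Nat.lt_pow_succ_log_self (by norm_num) n
    have hL11 : 11 ≤ L := Nat.le_log_of_pow_le (by norm_num) hlarge
    obtain ⟨t, ht1, ht2, ht3⟩ : ∃ t, 1 ≤ t ∧ 11 * t ≤ L ∧ L + 1 ≤ 22 * t :=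
      ⟨L / 11, by omega, by omega, by omega⟩
    have hlt := two_pow_sq_lt_ramseyNumber hH hIT ht1
      ((Nat.pow_le_pow_right (by norm_num) ht2).trans hLn)
    have h1 : Real.log n ≤ 22 * t := by
      have h : Real.log n ≤ Real.log ((2 : ℝ) ^ (22 * t)) := Real.log_le_log hn0 (by
        exact_mod_cast hnL.le.trans (Nat.pow_le_pow_right (by norm_num) ht3))
      rw [Real.log_pow] at h
      push_cast at h
      have ht0 : (0 : ℝ) ≤ 22 * t := by positivity
      nlinarith
    have h2 : 1 / 484 * Real.log n ^ 2 ≤ ((t * t : ℕ) : ℝ) := by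
      push_cast
      nlinarith
    calc (2 : ℝ) ^ (1 / 484 * Real.log n ^ 2) ≤ (2 : ℝ) ^ ((t * t : ℕ) : ℝ) :=
          Real.rpow_le_rpow_of_exponent_le (by norm_num) h2
      _ = ((2 ^ (t * t) : ℕ) : ℝ) := by rw [Real.rpow_natCast]; push_cast; rfl
      _ ≤ H.ramseyNumber n := by exact_mod_cast hlt.le

theorem not_exists_ramseyNumber_le_pow {V : Type*} [Finite V] {H : ThreeGraph V}
    (hH : H.tightComponents.encard ≤ 2) (hIT : ¬ H.IsIteratedTripartite) :
    ¬ ∃ c : ℕ, ∀ n : ℕ, H.ramseyNumber n ≤ n ^ c := by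
  rintro ⟨c, hc⟩
  -- At `n = 2 ^ (11 * t)` a bound `n ^ c` would force `t * t < 11 * t * c`, which fails for `t > 11
  -- * c`.
  have h := (two_pow_sq_lt_ramseyNumber hH hIT (t := 11 * c + 1) (by omega) le_rfl).trans_le
    (hc (2 ^ (11 * (11 * c + 1))))
  rw [← pow_mul] at h
  have := (Nat.pow_lt_pow_iff_right (by norm_num)).1 h
  nlinarith

end ThreeGraph

theorem theorem1p3 {V : Type*} [Finite V] (H : ThreeGraph V)
    (hH : H.tightComponents.encard ≤ 2) :
    (¬ H.IsIteratedTripartite →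
      ∃ c : ℝ, 0 < c ∧ ∀ n : ℕ, 1 ≤ n →
        (2 : ℝ) ^ (c * Real.log n ^ 2) ≤ (H.ramseyNumber n : ℝ)) ∧
    ((∃ c : ℕ, ∀ n : ℕ, H.ramseyNumber n ≤ n ^ c) ↔ H.IsIteratedTripartite) :=
  ⟨fun h => ThreeGraph.exists_two_rpow_le_ramseyNumber hH h,
    fun h => by
      by_contra hIT
      exact ThreeGraph.not_exists_ramseyNumber_le_pow hH hIT h,
    fun h => h.exists_ramseyNumber_le_pow⟩
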